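/- **Setting.** Let $d,n$ be integers, let $\mathrm P$ be a probability measure on $\mathbb R^d$ with finite second moment, let $X\sim \mathrm P$ and let $X_1,\dots,X_n$ be independent copies of $X$. Put $G=\mathbb E(XX^\top)$ and $N(\theta)=\theta^\top G\theta=\mathbb E\langle\theta,X\rangle^2$. Ratios follow the convention $0/0=1$ and $z/0=\infty$ for $z\neq0$. An inequality "$\mathbb P(A)\ge p$" means that $A$ contains a measurable event of probability at least $p$. **The energy estimator.** Let $\psi:\mathbb R\to\mathbb R$ be the odd function with $\psi(x)=-\log(1-x+x^2/2)$ for $0\le x\le1$ and $\psi(x)=\log 2$ for $x\ge1$. For $\lambda>0$ put $$\widehat N_\lambda(\theta)=\inf\Bigl\{t>0:\ \sum_{i=1}^n\psi\bigl[\lambda\bigl(t^{-1}\langle\theta,X_i\rangle^2-1\bigr)\bigr]\le0\Bigr\}.$$ **Parameters.** Let $\kappa>1$ and $\epsilon>0$, and put $$\lambda=\sqrt{\tfrac{2}{(\kappa-1)n}\bigl[\log(\epsilon^{-1})+0.73\,d\bigr]},\qquad \mu=\sqrt{\tfrac{2(\kappa-1)}{n}\bigl[\log(\epsilon^{-1})+0.73\,d\bigr]}+6.81\sqrt{\tfrac{2\kappa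 d}{n}},\qquad \delta=\frac{\mu}{1-2\mu}.$$ Assume that $4\mu<1$ (that is, $\delta<1/2$) and that $$n>\Bigl[20\sqrt{\kappa d}+\Bigl(\tfrac52+\tfrac1{2(\kappa-1)}\Bigr)\sqrt{2(\kappa-1)\bigl[\log(\epsilon^{-1})+0.73\,d\bigr]}\Bigr]^2 .$$ (For $\epsilon\ge 1/2$ the probability statement below is trivial.) **The construction.** Let $S_d$ be the unit sphere of $\mathbb R^d$ and $V=\operatorname{span}\{X_1,\dots,X_n\}$. Choose an orthonormal basis $(e_1,\dots,e_d)$ of $\mathbb R^d$, a radius $\rho>0$ with $$2\rho\sum_{i=1}^d\widehat N_\lambda(e_i)\le\delta^2\inf\bigl\{\widehat N_\lambda(\theta):\theta\in V\cap S_d\bigr\}$$ (the infimum being read as $0$ if $V=\{0\}$), and a finite $\rho$-net $\Theta_\rho\subset V\cap S_d$ of $V\cap S_d$. Let $\widehat G$ be a minimizer of $\operatorname{Tr}(H^2)$ over the matrices $H\in\mathbb R^{d\times d}$ such that $$H^\top=H,\qquad \operatorname{Im}(H)\subset V,\qquad (1-\delta)\widehat N_\lambda(\theta)\le\theta^\top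 H\theta\le(1+\delta)\widehat N_\lambda(\theta)\quad\text{for all }\theta\in\Theta_\rho .$$ **Proposition.** There is a map $\widehat G$ from samples in $(\mathbb R^d)^n$ to symmetric matrices, depending only on $d,n,\kappa,\epsilon$, which is a result of this construction for every sample for which the construction has a result, and which has the following property. For every $\mathrm P$ as above such that $$\sup\bigl\{\mathbb E\langle\theta,X\rangle^4:\theta\in\mathbb R^d,\ \mathbb E\langle\theta,X\rangle^2\le1\bigr\}\le\kappa ,$$ there is an event of probability at least $1-2\epsilon$ on which the construction has a result, and on which, for all $\theta\in\mathbb R^d$, $$\left|\frac{\theta^\top\widehat G\theta}{\theta^\top G\theta}-1\right|\le\frac{2\mu}{1-4\mu}.$$ On the same event, if $\lambda_1\ge\dots\ge\lambda_d$ and $\widehat\lambda_1\ge\dots\ge\widehat\lambda_d$ are the eigenvalues of $G$ and of $\widehat G$, counted with multiplicity, then $$\left|\frac{\widehat\lambda_i}{\lambda_i}-1\right|\le\frac{2\mu}{1-4\mu}\qquad(1\le i\le d).$$ Moreover, on this event, for every admissible choice of $(e_i)$, $\rho$ and $\Theta_\rho$ the minimization problem has a solution, and every solution satisfies the same two bounds.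 Finally, the bound is of order $\sqrt{\kappa[d+\log(\epsilon^{-1})]/n}$: there is a numerical constant $C$ such that, when $\epsilon\le1$, $$\frac{2\mu}{1-4\mu}\le\frac{C}{1-4\mu}\sqrt{\frac{\kappa\,[d+\log(\epsilon^{-1})]}{n}} .$$ -/

import Mathlib

open MeasureTheory ProbabilityTheory

noncomputable section

namespace RobustGram

/-- `ℝ^d` with its Euclidean norm and inner product. -/
abbrev Vec (d : ℕ) : Type := EuclideanSpace ℝ (Fin d)

/-- The energy `N(θ) = E ⟨θ, X⟩²` in direction `θ`, where `P` is the law of `X`. -/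
def energy {d : ℕ} (P : Measure (Vec d)) (θ : Vec d) : ℝ :=
  ∫ x, (inner ℝ θ x) ^ 2 ∂P

/-- The Gram matrix `G = E (X Xᵀ)`. -/
def gramMatrix {d : ℕ} (P : Measure (Vec d)) : Matrix (Fin d) (Fin d) ℝ :=
  Matrix.of fun i j => ∫ x, x i * x j ∂P

theorem gramMatrix_isHermitian {d : ℕ} (P : Measure (Vec d)) :
    (gramMatrix P).IsHermitian := by
  ext i j
  simp [gramMatrix, Matrix.conjTranspose_apply, mul_comm]

/-- `sup { E ⟨θ, X⟩⁴ : θ ∈ ℝ^d, E ⟨θ, X⟩² ≤ 1 }`, as an element of `[0, ∞]`. -/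
def kurtosis {d : ℕ} (P : Measure (Vec d)) : ENNReal :=
  ⨆ (θ : Vec d) (_ : energy P θ ≤ 1), ∫⁻ x, ENNReal.ofReal ((inner ℝ θ x) ^ 4) ∂P

/-- The influence function on `[0, ∞)`. -/
def psiPos (x : ℝ) : ℝ :=
  if 1 ≤ x then Real.log 2 else -Real.log (1 - x + x ^ 2 / 2)

/-- The influence function, extended to `ℝ` as an odd function. -/
def psi (x : ℝ) : ℝ :=
  if 0 ≤ x then psiPos x else -psiPos (-x)

/-- The robust estimator of the energy in direction `θ` at scale `lam`, on the sample `x`: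
`inf { t > 0 : ∑ᵢ ψ(lam (t⁻¹ ⟨θ, xᵢ⟩² - 1)) ≤ 0 }`. -/
def Nhat {d n : ℕ} (lam : ℝ) (x : Fin n → Vec d) (θ : Vec d) : ℝ :=
  sInf {t : ℝ | 0 < t ∧ ∑ i, psi (lam * (t⁻¹ * (inner ℝ θ (x i)) ^ 2 - 1)) ≤ 0}

/-- `log(ε⁻¹) + 0.73 d`. -/
def logTerm (ε : ℝ) (d : ℕ) : ℝ := Real.log ε⁻¹ + 0.73 * d

/-- The scale parameter `λ`. -/
def scale (κ ε : ℝ) (n d : ℕ) : ℝ :=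
  √(2 / ((κ - 1) * n) * logTerm ε d)

/-- The quantity `μ`. -/
def mu (κ ε : ℝ) (n d : ℕ) : ℝ :=
  √(2 * (κ - 1) / n * logTerm ε d) + 6.81 * √(2 * κ * d / n)

/-- The accuracy `δ = μ / (1 - 2 μ)` of the robust energy estimator. -/
def delta (κ ε : ℝ) (n d : ℕ) : ℝ :=
  mu κ ε n d / (1 - 2 * mu κ ε n d)

/-- The lower bound required of the sample size. -/
def sampleBound (κ ε : ℝ) (d : ℕ) : ℝ :=
  (20 * √(κ * d) + (5 / 2 + 1 / (2 * (κ - 1))) * √(2 * (κ - 1) * logTerm ε d)) ^ 2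

/-- `|a / b - 1| ≤ c`, with the convention that `0 / 0 = 1` and that
`z / 0` is infinite for `z ≠ 0`. -/
def RatioErrLE (a b c : ℝ) : Prop :=
  if b = 0 then a = 0 ∧ 0 ≤ c else |a / b - 1| ≤ c

/-- The quadratic form `θᵀ H θ`. -/
def quadForm {d : ℕ} (H : Matrix (Fin d) (Fin d) ℝ) (θ : Vec d) : ℝ :=
  θ.ofLp ⬝ᵥ (H.mulVec θ.ofLp)

/-- `span {x₁, …, xₙ} ∩ S_d`, where `S_d` is the unit sphere. -/
def spanSphere {d n : ℕ} (x : Fin n → Vec d) : Set (Vec d) :=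
  {θ | θ ∈ Submodule.span ℝ (Set.range x) ∧ ‖θ‖ = 1}

/-- `Θ` is a (finite) `ρ`-net of `span {x₁, …, xₙ} ∩ S_d`. -/
def IsNet {d n : ℕ} (x : Fin n → Vec d) (ρ : ℝ) (Θ : Finset (Vec d)) : Prop :=
  (∀ ξ ∈ Θ, ξ ∈ spanSphere x) ∧ ∀ θ ∈ spanSphere x, ∃ ξ ∈ Θ, ‖θ - ξ‖ ≤ ρ

/-- The infimum of `N` over `span {x₁, …, xₙ} ∩ S_d`. -/
def lambdaMin {d n : ℕ} (N : Vec d → ℝ) (x : Fin n → Vec d) : ℝ :=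
  sInf (N '' spanSphere x)

/-- `ρ > 0` and `ρ ≤ δ² λmin / (2 ∑ᵢ N(eᵢ))`. The inequality is written without a quotient, so
that every `ρ > 0` is allowed in the degenerate case where all the `xᵢ` and `N` vanish. -/
def IsSmallRadius {d n : ℕ} (δ : ℝ) (N : Vec d → ℝ) (x : Fin n → Vec d)
    (e : OrthonormalBasis (Fin d) ℝ (Vec d)) (ρ : ℝ) : Prop :=
  0 < ρ ∧ ρ * (2 * ∑ i, N (e i)) ≤ δ ^ 2 * lambdaMin N x

/-- The constraints: `H` is symmetric, its image is contained in `span {x₁, …, xₙ}` and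
`N(θ) (1 - δ) ≤ θᵀ H θ ≤ N(θ) (1 + δ)` for every `θ ∈ Θ`. -/
def feasible {d n : ℕ} (δ : ℝ) (N : Vec d → ℝ) (x : Fin n → Vec d) (Θ : Finset (Vec d)) :
    Set (Matrix (Fin d) (Fin d) ℝ) :=
  {H | H.IsSymm ∧
    (∀ v : Vec d, WithLp.toLp 2 (H.mulVec v.ofLp) ∈ Submodule.span ℝ (Set.range x)) ∧
    ∀ θ ∈ Θ, N θ * (1 - δ) ≤ quadForm H θ ∧ quadForm H θ ≤ N θ * (1 + δ)}

/-- `H` minimizes `Tr(H²)` under the constraints. -/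
def IsGramSolution {d n : ℕ} (δ : ℝ) (N : Vec d → ℝ) (x : Fin n → Vec d)
    (Θ : Finset (Vec d)) (H : Matrix (Fin d) (Fin d) ℝ) : Prop :=
  H ∈ feasible δ N x Θ ∧ ∀ K ∈ feasible δ N x Θ, (H * H).trace ≤ (K * K).trace

/-- The triple `(e, ρ, Θ)` is a legitimate choice in the construction on the sample `x`. -/
def IsAdmissible {d n : ℕ} (κ ε : ℝ) (x : Fin n → Vec d)
    (e : OrthonormalBasis (Fin d) ℝ (Vec d)) (ρ : ℝ) (Θ : Finset (Vec d)) : Prop :=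
  IsSmallRadius (delta κ ε n d) (Nhat (scale κ ε n d) x) x e ρ ∧ IsNet x ρ Θ

/-- `H` is a result of the construction on the sample `x`, for some legitimate choice of
the orthonormal basis, of the radius `ρ` and of the `ρ`-net. -/
def IsOutput {d n : ℕ} (κ ε : ℝ) (x : Fin n → Vec d) (H : Matrix (Fin d) (Fin d) ℝ) : Prop :=
  ∃ e ρ Θ, IsAdmissible κ ε x e ρ Θ ∧
    IsGramSolution (delta κ ε n d) (Nhat (scale κ ε n d) x) x Θ H

/-- `|θᵀ H θ / θᵀ G θ - 1| ≤ c` for all `θ`, and the eigenvalues of `H` and of `G`, both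
listed in decreasing order with their multiplicities, satisfy the same inequality. -/
def IsAccurate {d : ℕ} (P : Measure (Vec d)) (c : ℝ) (H : Matrix (Fin d) (Fin d) ℝ) : Prop :=
  (∀ θ : Vec d, RatioErrLE (quadForm H θ) (quadForm (gramMatrix P) θ) c) ∧
  ∃ hH : H.IsHermitian, ∀ i,
    RatioErrLE (hH.eigenvalues₀ i) ((gramMatrix_isHermitian P).eigenvalues₀ i) c

end RobustGram

end

/-! The proof has a probabilistic half, which controls the robust energies in all directions at
once, and a deterministic half, which passes from these energies to a matrix.

Probabilistic half. The function `psi` satisfies `psi z ≤ log (1 + z + z² / 2)`, so its exponential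
moments need only second moments of `z`, that is, fourth moments of the sample. Uniformity in the
direction comes from a PAC-Bayesian argument: with a standard Gaussian prior and its translates as
posteriors, a single Markov inequality holds for all translations `ξ`, at the price of the relative
entropy `‖ξ‖² / 2` (`exists_event_pacBayes`). This controls averages over perturbed directions,
whereas the estimator uses `psi` at the direction itself. As `psi + x²` is convex, Jensen's
inequality makes up the difference at the cost of a variance. Since `psi` is bounded, the variance
may be truncated, and the truncated variance is absorbed by a logarithmic term inside the average,
which remains cheap after exponentiation (`psi_le_integral_softPsi`). Whitening the sample by the
Gram matrix turns `‖ξ‖²` into a multiple of the energy, and the kurtosis bound controls the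
remaining moments (`exists_event_sum_psi_energy_le`).

The deviation bound is used with sign `+1` at energy `1 - δ` and with sign `-1` at energy `1 + δ`.
The choice of parameters makes both right-hand sides have the sign that brackets the zero of the
estimating sum, whence `(1 - δ) Nhat ≤ N ≤ (1 + δ) Nhat` in every direction, with probability at
least `1 - 2ε` (`exists_event_Nhat`).

Deterministic half. On this event the span of the sample is the image of `G`, and `G` satisfies the
constraints. A minimizer `H` therefore exists and has Frobenius norm at most that of `G`, which is
at most `Tr G ≤ (1 + δ) ∑ Nhat (e i)`. Both quadratic forms are then Lipschitz on the sphere with a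
known constant, and the radius `ρ` is small enough to carry the constraints from the net to the
sphere (`abs_sub_le_of_net`). Off the span, both forms see only the projection. The eigenvalue bound
follows by Courant–Fischer (`le_of_sum_mul_inner_sq_le`). -/

namespace RobustGram

/-! ### The influence function -/

theorem one_sub_add_sq_half_pos (x : ℝ) : 0 < 1 - x + x ^ 2 / 2 := by
  nlinarith [sq_nonneg (x - 1)]

theorem one_add_add_sq_half_pos (x : ℝ) : 0 < 1 + x + x ^ 2 / 2 := by
  nlinarith [sq_nonneg (x + 1)]

theorem psi_neg (x : ℝ) : psi (-x) = -psi x := by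
  unfold psi
  rcases lt_trichotomy x 0 with h | h | h
  · rw [if_pos (by linarith), if_neg (by linarith)]; simp
  · subst h; norm_num [psiPos]
  · rw [if_neg (by linarith), if_pos h.le]; simp

/-- The derivative of `psi`. -/
noncomputable def psiDeriv (x : ℝ) : ℝ := 2 * max 0 (1 - |x|) / (1 + max 0 (1 - |x|) ^ 2)

/-- Since `1 - x + x² / 2 = (1 + (1 - x)²) / 2`, the logarithmic branch has derivative `2t / (1 +
t²)` with `t = 1 - x`. It vanishes at `x = 1`, so the two branches are glued with a common
derivative. -/
theorem hasDerivAt_psiPos (x : ℝ) :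
    HasDerivAt psiPos (2 * max 0 (1 - x) / (1 + max 0 (1 - x) ^ 2)) x := by
  have hf : ∀ y : ℝ, y ≤ 1 → HasDerivAt (fun x : ℝ => -Real.log (1 - x + x ^ 2 / 2))
      (2 * max 0 (1 - y) / (1 + max 0 (1 - y) ^ 2)) y := by
    intro y hy
    have h1 : HasDerivAt (fun x : ℝ => 1 - x + x ^ 2 / 2) (-1 + y) y := by
      have := ((hasDerivAt_id y).const_sub 1).add (((hasDerivAt_id y).pow 2).div_const 2)
      exact this.congr_deriv (by simp)
    have hp := one_sub_add_sq_half_pos y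
    refine (h1.log hp.ne').neg.congr_deriv ?_
    rw [max_eq_right (by linarith)]
    have : (1 + (1 - y) ^ 2) = 2 * (1 - y + y ^ 2 / 2) := by ring
    rw [this]
    field_simp
    ring
  rcases lt_trichotomy x 1 with h | h | h
  · refine (hf x h.le).congr_of_eventuallyEq ?_
    filter_upwards [eventually_lt_nhds h] with y hy
    simp [psiPos, not_le.2 hy]
  · subst h
    have e : (2 * max 0 (1 - (1:ℝ)) / (1 + max 0 (1 - (1:ℝ)) ^ 2)) = 0 := by simp
    have h1 := hf 1 le_rfl
    rw [e] at h1 ⊢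
    have hl : HasDerivWithinAt psiPos 0 (Set.Iic 1) 1 := by
      refine h1.hasDerivWithinAt.congr (fun y hy => ?_) ?_
      · rcases eq_or_lt_of_le (Set.mem_Iic.1 hy) with rfl | hy
        · norm_num [psiPos]
          rw [← Real.log_inv]; norm_num
        · simp [psiPos, not_le.2 hy]
      · norm_num [psiPos]
        rw [← Real.log_inv]; norm_num
    have hr : HasDerivWithinAt psiPos 0 (Set.Ici 1) 1 := by
      refine (hasDerivWithinAt_const (1:ℝ) (Set.Ici 1) (Real.log 2)).congr (fun y hy => ?_) ?_
      · simp [psiPos, Set.mem_Ici.1 hy]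
      · simp [psiPos]
    have := hl.union hr
    rwa [Set.Iic_union_Ici, hasDerivWithinAt_univ] at this
  · rw [max_eq_left (by linarith)]
    simp only [mul_zero, zero_div]
    refine (hasDerivAt_const x (Real.log 2)).congr_of_eventuallyEq ?_
    filter_upwards [eventually_gt_nhds h] with y hy
    simp [psiPos, hy.le]

theorem hasDerivAt_psi (x : ℝ) : HasDerivAt psi (psiDeriv x) x := by
  have hneg : ∀ y : ℝ, HasDerivAt (fun x => -psiPos (-x))
      (2 * max 0 (1 - -y) / (1 + max 0 (1 - -y) ^ 2)) y := by
    intro y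
    have := ((hasDerivAt_psiPos (-y)).comp y (hasDerivAt_neg y)).neg
    exact this.congr_deriv (by simp)
  unfold psiDeriv
  rcases lt_trichotomy x 0 with h | h | h
  · rw [abs_of_neg h]
    refine (hneg x).congr_of_eventuallyEq ?_
    filter_upwards [eventually_lt_nhds h] with y hy
    simp [psi, not_le.2 hy]
  · subst h
    have h0 : psiPos 0 = 0 := by norm_num [psiPos]
    have hl : HasDerivWithinAt psi (2 * max 0 (1 - |(0:ℝ)|) / (1 + max 0 (1 - |(0:ℝ)|) ^ 2))
        (Set.Iic 0) 0 := by
      have := (hneg 0).hasDerivWithinAt (s := Set.Iic 0)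
      simp only [neg_zero] at this
      rw [abs_zero]
      refine this.congr (fun y hy => ?_) ?_
      · rcases eq_or_lt_of_le (Set.mem_Iic.1 hy) with rfl | hy
        · simp [psi, h0]
        · simp [psi, not_le.2 hy]
      · simp [psi, h0]
    have hr : HasDerivWithinAt psi (2 * max 0 (1 - |(0:ℝ)|) / (1 + max 0 (1 - |(0:ℝ)|) ^ 2))
        (Set.Ici 0) 0 := by
      have := (hasDerivAt_psiPos 0).hasDerivWithinAt (s := Set.Ici 0)
      rw [abs_zero]
      refine this.congr (fun y hy => ?_) ?_
      · simp [psi, Set.mem_Ici.1 hy]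
      · simp [psi]
    have := hl.union hr
    rwa [Set.Iic_union_Ici, hasDerivWithinAt_univ] at this
  · rw [abs_of_pos h]
    refine (hasDerivAt_psiPos x).congr_of_eventuallyEq ?_
    filter_upwards [eventually_gt_nhds h] with y hy
    simp [psi, hy.le]

theorem continuous_psi : Continuous psi :=
  continuous_iff_continuousAt.2 fun x => (hasDerivAt_psi x).continuousAt

theorem psiDeriv_nonneg (x : ℝ) : 0 ≤ psiDeriv x := by
  unfold psiDeriv; positivity

theorem monotone_psi : Monotone psi :=
  monotone_of_hasDerivAt_nonneg hasDerivAt_psi psiDeriv_nonneg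

theorem psi_of_one_le {x : ℝ} (h : 1 ≤ x) : psi x = Real.log 2 := by
  simp [psi, psiPos, h, zero_le_one.trans h]

theorem psi_le_log_two (x : ℝ) : psi x ≤ Real.log 2 :=
  (monotone_psi (le_max_left x 1)).trans_eq (psi_of_one_le (le_max_right x 1))

theorem neg_log_two_le_psi (x : ℝ) : -Real.log 2 ≤ psi x := by
  have := psi_le_log_two (-x)
  rw [psi_neg] at this
  linarith

theorem abs_psi_le (x : ℝ) : |psi x| ≤ Real.log 2 :=
  abs_le.2 ⟨neg_log_two_le_psi x, psi_le_log_two x⟩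

/-- On `[0, 1]` this is `(1 - z + z² / 2) (1 + z + z² / 2) = 1 + z⁴ / 4 ≥ 1`. On `(-1, 0)` there is
equality, and outside `[-1, 1]` it suffices to compare `1 + z + z² / 2` with `2` or `1 / 2`. -/
theorem psi_le_log (z : ℝ) : psi z ≤ Real.log (1 + z + z ^ 2 / 2) := by
  have hp := one_add_add_sq_half_pos z
  have hm := one_sub_add_sq_half_pos z
  rcases le_or_gt 1 z with h1 | h1
  · rw [psi_of_one_le h1]
    exact Real.log_le_log (by norm_num) (by nlinarith)
  rcases le_or_gt 0 z with h0 | h0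
  · simp only [psi, psiPos, if_pos h0, if_neg (not_le.2 h1)]
    rw [← Real.log_inv]
    refine Real.log_le_log (inv_pos.2 hm) ?_
    rw [inv_le_iff_one_le_mul₀ hm]
    nlinarith [sq_nonneg (z ^ 2)]
  simp only [psi, if_neg (not_le.2 h0), psiPos]
  split_ifs with h
  · rw [← Real.log_inv]
    exact Real.log_le_log (by norm_num) (by nlinarith [sq_nonneg (z + 1)])
  · simp

theorem exp_psi_le (z : ℝ) : Real.exp (psi z) ≤ 1 + z + z ^ 2 / 2 := by
  rw [← Real.exp_log (one_add_add_sq_half_pos z)]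
  exact Real.exp_le_exp.2 (psi_le_log z)

theorem exp_psi_le_two (z : ℝ) : Real.exp (psi z) ≤ 2 := by
  rw [← Real.exp_log (by norm_num : (0:ℝ) < 2)]
  exact Real.exp_le_exp.2 (psi_le_log_two z)

/-- The derivative of `psi` is 2-Lipschitz: `t ↦ 2t / (1 + t²)` is 2-Lipschitz on `t ≥ 0`, and `x ↦
max 0 (1 - |x|)` is 1-Lipschitz. -/
theorem convexOn_psi_add_sq : ConvexOn ℝ Set.univ fun x => psi x + x ^ 2 := by
  have hd : ∀ x, HasDerivAt (fun x => psi x + x ^ 2) (psiDeriv x + 2 * x) x := by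
    intro x
    have := (hasDerivAt_psi x).add ((hasDerivAt_id x).pow 2)
    exact this.congr_deriv (by simp)
  refine Monotone.convexOn_univ_of_deriv (fun x => (hd x).differentiableAt) ?_
  have : deriv (fun x => psi x + x ^ 2) = fun x => psiDeriv x + 2 * x := funext fun x => (hd x).deriv
  rw [this]
  intro x y hxy
  have hlip : ∀ s t : ℝ, 0 ≤ s → s ≤ t → 2 * t / (1 + t ^ 2) - 2 * s / (1 + s ^ 2) ≤ 2 * (t - s) ∧
      -(2 * (t - s)) ≤ 2 * t / (1 + t ^ 2) - 2 * s / (1 + s ^ 2) := by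
    intro s t hs hst
    have e : 2 * t / (1 + t ^ 2) - 2 * s / (1 + s ^ 2) =
        2 * (t - s) * ((1 - s * t) / ((1 + t ^ 2) * (1 + s ^ 2))) := by
      field_simp; ring
    have hden : 0 < (1 + t ^ 2) * (1 + s ^ 2) := by positivity
    have b1 : (1 - s * t) / ((1 + t ^ 2) * (1 + s ^ 2)) ≤ 1 := by
      rw [div_le_one hden]
      have : 0 ≤ s * t := mul_nonneg hs (hs.trans hst)
      nlinarith [sq_nonneg (s * t), sq_nonneg s, sq_nonneg t]
    have b2 : -1 ≤ (1 - s * t) / ((1 + t ^ 2) * (1 + s ^ 2)) := by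
      rw [le_div_iff₀ hden]
      nlinarith [sq_nonneg (s * t), sq_nonneg (s - t)]
    rw [e]
    constructor <;> nlinarith
  have ha : |max 0 (1 - |y|) - max 0 (1 - |x|)| ≤ y - x := by
    have h1 := abs_max_sub_max_le_abs (1 - |y|) (1 - |x|) 0
    rw [max_comm 0, max_comm 0]
    refine h1.trans ?_
    have : 1 - |y| - (1 - |x|) = |x| - |y| := by ring
    rw [this]
    refine (abs_abs_sub_abs_le x y).trans_eq ?_
    rw [abs_sub_comm, abs_of_nonneg (by linarith)]
  simp only [psiDeriv]
  rw [abs_le] at ha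
  rcases le_total (max 0 (1 - |x|)) (max 0 (1 - |y|)) with h | h
  · have := hlip _ _ (le_max_left _ _) h
    linarith [this.2, ha.2]
  · have := hlip _ _ (le_max_left _ _) h
    linarith [this.1, ha.1]

/-- Jensen's inequality for `psi`, up to a variance term. -/
theorem psi_integral_le {Ω : Type*} [MeasurableSpace Ω] {μ : Measure Ω} [IsProbabilityMeasure μ]
    {h : Ω → ℝ} (h1 : Integrable h μ) (h2 : Integrable (fun x => h x ^ 2) μ) :
    psi (∫ x, h x ∂μ) ≤ ∫ x, psi (h x) ∂μ + ∫ x, (h x - ∫ y, h y ∂μ) ^ 2 ∂μ := by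
  have hpsi : Integrable (fun x => psi (h x)) μ :=
    Integrable.of_bound (continuous_psi.comp_aestronglyMeasurable h1.1) (Real.log 2)
      (ae_of_all _ fun x => abs_psi_le _)
  have hc : Continuous fun x => psi x + x ^ 2 := continuous_psi.add (continuous_pow 2)
  have := convexOn_psi_add_sq.map_integral_le (μ := μ) (f := h) hc.continuousOn isClosed_univ
    (ae_of_all _ fun _ => Set.mem_univ _) h1 (hpsi.add h2)
  rw [integral_add hpsi h2] at this
  set c := ∫ x, h x ∂μ with hcdef
  have hv : ∫ x, (h x - c) ^ 2 ∂μ = ∫ x, h x ^ 2 ∂μ - c ^ 2 := by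
    have e : (fun x => (h x - c) ^ 2) = fun x => h x ^ 2 - 2 * c * h x + c ^ 2 := by
      ext x; ring
    have h3 : Integrable (fun x => h x ^ 2 - 2 * c * h x) μ := h2.sub (h1.const_mul _)
    rw [e, integral_add h3 (integrable_const _), integral_sub h2 (h1.const_mul _),
      integral_const_mul, ← hcdef]
    simp; ring
  rw [hv]
  linarith

/-! ### Moments of the standard normal law -/

theorem integrable_pow_gaussianReal (v : NNReal) (k : ℕ) :
    Integrable (fun x : ℝ => x ^ k) (gaussianReal 0 v) := by
  have h := memLp_id_gaussianReal (μ := 0) (v := v) (k : NNReal)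
  have := (h.integrable_norm_pow' (p := k))
  refine this.mono' (by fun_prop) (ae_of_all _ fun x => ?_)
  simp

theorem integral_odd_gaussianReal {f : ℝ → ℝ} (hf : ∀ x, f (-x) = -f x) (v : NNReal) :
    ∫ x, f x ∂(gaussianReal 0 v) = 0 := by
  have h := gaussianReal_map_neg (μ := 0) (v := v)
  rw [neg_zero] at h
  have e : ∫ x, f x ∂(gaussianReal 0 v) = ∫ x, f (-x) ∂(gaussianReal 0 v) := by
    conv_lhs => rw [← h]
    exact integral_map_equiv (MeasurableEquiv.neg ℝ) f
  simp_rw [hf, integral_neg] at e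
  linarith

theorem integral_neg_gaussianReal (f : ℝ → ℝ) (v : NNReal) :
    ∫ x, f (-x) ∂(gaussianReal 0 v) = ∫ x, f x ∂(gaussianReal 0 v) := by
  have h := gaussianReal_map_neg (μ := 0) (v := v)
  rw [neg_zero] at h
  conv_rhs => rw [← h]
  exact (integral_map_equiv (MeasurableEquiv.neg ℝ) f).symm

theorem integral_sq_gaussianReal : ∫ x, x ^ 2 ∂(gaussianReal 0 1) = 1 := by
  have h := variance_id_gaussianReal (μ := 0) (v := 1)
  rw [variance_of_integral_eq_zero aemeasurable_id (by simp)] at h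
  simpa using h

/-- The fourth moment is the fourth derivative at `0` of the moment generating function `exp (t² /
2)`. Each derivative is a polynomial times this exponential. -/
theorem integral_pow_four_gaussianReal : ∫ x, x ^ 4 ∂(gaussianReal 0 1) = 3 := by
  have hm := mgf_id_gaussianReal (μ := 0) (v := 1)
  have hd : ∀ (p p' : ℝ → ℝ), (∀ t, HasDerivAt p (p' t) t) →
      deriv (fun t : ℝ => p t * Real.exp (t ^ 2 / 2)) =
        fun t => (p' t + t * p t) * Real.exp (t ^ 2 / 2) := by
    intro p p' hp
    ext t
    have h2 : HasDerivAt (fun t : ℝ => t ^ 2 / 2) t t := by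
      have := ((hasDerivAt_id t).pow 2).div_const 2
      exact this.congr_deriv (by simp)
    have := (hp t).mul h2.exp
    exact (this.congr_deriv (by ring)).deriv
  have h0 : (0:ℝ) ∈ interior (integrableExpSet id (gaussianReal 0 1)) := by
    rw [integrableExpSet_id_gaussianReal]; simp
  have h := iteratedDeriv_mgf_zero h0 4
  rw [hm] at h
  have e0 : (fun t : ℝ => Real.exp (0 * t + ((1 : NNReal) : ℝ) * t ^ 2 / 2)) =
      fun t => 1 * Real.exp (t ^ 2 / 2) := by ext t; simp
  have d1 := hd (fun _ => 1) (fun _ => 0) (fun t => hasDerivAt_const _ _)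
  have d2 := hd (fun t => 0 + t * 1) (fun _ => 1) (fun t => by
    refine ((hasDerivAt_id t).congr_of_eventuallyEq (Filter.Eventually.of_forall fun y => ?_))
    simp)
  have d3 := hd (fun t => 1 + t * (0 + t * 1)) (fun t => 2 * t) (fun t => by
    have := ((hasDerivAt_id t).pow 2).const_add 1
    refine (this.congr_of_eventuallyEq (Filter.Eventually.of_forall fun y => ?_)).congr_deriv ?_
    · simp; ring
    · simp)
  have d4 := hd (fun t => 2 * t + t * (1 + t * (0 + t * 1))) (fun t => 3 + 3 * t ^ 2) (fun t => by
    have := ((hasDerivAt_id t).const_mul 3).add ((hasDerivAt_id t).pow 3)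
    refine (this.congr_of_eventuallyEq (Filter.Eventually.of_forall fun y => ?_)).congr_deriv ?_
    · simp; ring
    · simp)
  rw [e0] at h
  simp only [iteratedDeriv_succ, iteratedDeriv_zero] at h
  rw [d1, d2, d3, d4] at h
  simpa using h.symm

theorem integrable_quartic_gaussianReal (a b c d f : ℝ) :
    Integrable (fun g : ℝ => a + b * g + c * g ^ 2 + d * g ^ 3 + f * g ^ 4)
      (gaussianReal 0 1) := by
  have hp := fun k => integrable_pow_gaussianReal 1 k
  have h1 : Integrable (fun g : ℝ => g) (gaussianReal 0 1) := by simpa using hp 1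
  exact ((((integrable_const _).add (h1.const_mul _)).add ((hp 2).const_mul _)).add
    ((hp 3).const_mul _)).add ((hp 4).const_mul _)

theorem integral_quartic_gaussianReal (a b c d f : ℝ) :
    ∫ g : ℝ, (a + b * g + c * g ^ 2 + d * g ^ 3 + f * g ^ 4) ∂(gaussianReal 0 1) =
      a + c + 3 * f := by
  have i1 : Integrable (fun g : ℝ => a + c * g ^ 2 + f * g ^ 4) (gaussianReal 0 1) := by
    simpa using integrable_quartic_gaussianReal a 0 c 0 f
  have i2 : Integrable (fun g : ℝ => b * g + d * g ^ 3) (gaussianReal 0 1) := by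
    simpa using integrable_quartic_gaussianReal 0 b 0 d 0
  have i3 : Integrable (fun g : ℝ => a + c * g ^ 2) (gaussianReal 0 1) := by
    simpa using integrable_quartic_gaussianReal a 0 c 0 0
  have e : (fun g : ℝ => a + b * g + c * g ^ 2 + d * g ^ 3 + f * g ^ 4) =
      fun g => (a + c * g ^ 2 + f * g ^ 4) + (b * g + d * g ^ 3) := by ext g; ring
  rw [e, integral_add i1 i2,
    integral_odd_gaussianReal (f := fun g : ℝ => b * g + d * g ^ 3) (by intro x; ring),
    integral_add i3 ((integrable_pow_gaussianReal 1 4).const_mul f),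
    integral_add (integrable_const a) ((integrable_pow_gaussianReal 1 2).const_mul c),
    integral_const_mul, integral_const_mul, integral_sq_gaussianReal,
    integral_pow_four_gaussianReal]
  simp; ring

/-! ### Gaussian smoothing of the influence function -/

/-- At `Y = 6 / 11` the argument of the logarithm is exactly `4`. Below this value, `log (1 + u) ≥
2u / (u + 2)` suffices. -/
theorem min_le_log_one_add {Y : ℝ} (hY : 0 ≤ Y) :
    min (Real.log 4) Y ≤ Real.log (1 + 11 / 2 * Y) := by
  rcases le_or_gt (6 / 11) Y with h | h
  · exact (min_le_left _ _).trans (Real.log_le_log (by norm_num) (by linarith))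
  · refine (min_le_right _ _).trans ?_
    refine le_trans ?_ (Real.le_log_one_add_of_nonneg (by positivity))
    rw [le_div_iff₀ (by positivity)]
    nlinarith

/-- Symmetrization makes the logarithmic correction dominate the variance term. -/
theorem min_le_half_log_add_log (x y τ : ℝ) :
    2 * min (Real.log 4) (4 * x ^ 2 + 2 * τ ^ 2) ≤
      Real.log (1 + 22 * (x + y) ^ 2 + 11 * τ ^ 2) +
        Real.log (1 + 22 * (x - y) ^ 2 + 11 * τ ^ 2) := by
  have hp : 0 < 1 + 22 * (x + y) ^ 2 + 11 * τ ^ 2 := by positivity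
  have hm : 0 < 1 + 22 * (x - y) ^ 2 + 11 * τ ^ 2 := by positivity
  rw [← Real.log_mul hp.ne' hm.ne']
  obtain ⟨D, hD⟩ : ∃ D, D = 1 + 11 * τ ^ 2 := ⟨_, rfl⟩
  have hD1 : 1 ≤ D := by rw [hD]; nlinarith [sq_nonneg τ]
  rcases le_or_gt (22 * x ^ 2) D with h | h
  -- In this regime the product is smallest at `y = 0`: its excess over the value there is `44 y² (D
  -- + 11 y² - 22 x²)`.
  · have h2 : (1 + 11 / 2 * (4 * x ^ 2 + 2 * τ ^ 2)) ^ 2 ≤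
        (1 + 22 * (x + y) ^ 2 + 11 * τ ^ 2) * (1 + 22 * (x - y) ^ 2 + 11 * τ ^ 2) := by
      have : 0 ≤ y ^ 2 * (D + 11 * y ^ 2 - 22 * x ^ 2) :=
        mul_nonneg (sq_nonneg _) (by nlinarith [sq_nonneg y])
      subst hD
      nlinarith
    refine le_trans ?_ (Real.log_le_log (by positivity) h2)
    rw [Real.log_pow]
    have := min_le_log_one_add (Y := 4 * x ^ 2 + 2 * τ ^ 2) (by positivity)
    push_cast
    linarith
  -- In this regime the product may be smaller at a nonzero `y`. Subtracting `88 D x²` leaves the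
  -- square `(D - 22 (x² - y²))²`.
  · have h2 : 88 * D * x ^ 2 ≤
        (1 + 22 * (x + y) ^ 2 + 11 * τ ^ 2) * (1 + 22 * (x - y) ^ 2 + 11 * τ ^ 2) := by
      have : 0 ≤ (D - 22 * (x ^ 2 - y ^ 2)) ^ 2 := sq_nonneg _
      subst hD
      nlinarith
    obtain ⟨q, hq⟩ : ∃ q, q = 88 * D * x ^ 2 := ⟨_, rfl⟩
    rw [← hq] at h2
    have hq4 : 4 * D ^ 2 ≤ q := by rw [hq]; nlinarith
    have hq0 : 0 < q := by nlinarith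
    refine le_trans ?_ (Real.log_le_log hq0 h2)
    have l4 : Real.log 4 = 2 * Real.log 2 := by
      rw [show (4:ℝ) = 2 ^ 2 by norm_num, Real.log_pow]; norm_num
    have l2 := Real.log_two_gt_d9
    -- For `q ≥ 16` the bound `log 4` in the minimum is used. For `4 ≤ q < 16` the other bound is at
    -- most `q / 11`, which lies below `log q`.
    rcases le_or_gt 16 q with h16 | h16
    · have : 2 * Real.log 4 = Real.log 16 := by
        rw [show (16:ℝ) = 4 ^ 2 by norm_num, Real.log_pow]; norm_num
      have h3 := Real.log_le_log (by norm_num) h16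
      have := min_le_left (Real.log 4) (4 * x ^ 2 + 2 * τ ^ 2)
      linarith
    · have h3 := min_le_right (Real.log 4) (4 * x ^ 2 + 2 * τ ^ 2)
      have h4 : 8 * x ^ 2 + 4 * τ ^ 2 ≤ q / 11 := by
        rw [hq]
        have : τ ^ 2 = (D - 1) / 11 := by rw [hD]; ring
        rw [this]
        nlinarith
      have h5 : q / 11 ≤ Real.log q := by
        rcases le_or_gt 8 q with h8 | h8
        · have : Real.log 8 = 3 * Real.log 2 := by
            rw [show (8:ℝ) = 2 ^ 3 by norm_num, Real.log_pow]; norm_num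
          have := Real.log_le_log (by norm_num) h8
          linarith
        · have := Real.log_le_log (by norm_num) (show (4:ℝ) ≤ q by nlinarith)
          linarith
      linarith

/-- The logarithmic perturbation of the influence function. -/
noncomputable def softPsi (e lam s w : ℝ) : ℝ :=
  psi (e * (w ^ 2 - s ^ 2 - lam)) + Real.log (1 + 22 * s ^ 2 * w ^ 2 + 11 * s ^ 4)

theorem log_correction_le (s w : ℝ) :
    |Real.log (1 + 22 * s ^ 2 * w ^ 2 + 11 * s ^ 4)| ≤ 22 * s ^ 2 * w ^ 2 + 11 * s ^ 4 := by
  rw [abs_of_nonneg (Real.log_nonneg (by nlinarith [sq_nonneg (s * w), sq_nonneg (s ^ 2)]))]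
  refine (Real.log_le_sub_one_of_pos (by positivity)).trans ?_
  linarith

theorem continuous_log_correction (s : ℝ) :
    Continuous fun w : ℝ => Real.log (1 + 22 * s ^ 2 * w ^ 2 + 11 * s ^ 4) := by
  refine Continuous.log (by fun_prop) fun w => ?_
  positivity

theorem integrable_shift_sq (m s : ℝ) :
    Integrable (fun g : ℝ => (m + s * g) ^ 2) (gaussianReal 0 1) := by
  have e : (fun g : ℝ => (m + s * g) ^ 2) =
      fun g => m ^ 2 + 2 * m * s * g ^ 1 + s ^ 2 * g ^ 2 := by ext g; ring
  rw [e]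
  exact ((integrable_const _).add ((integrable_pow_gaussianReal 1 1).const_mul _)).add
    ((integrable_pow_gaussianReal 1 2).const_mul _)

theorem integrable_log_correction (m s : ℝ) :
    Integrable (fun g => Real.log (1 + 22 * s ^ 2 * (m + s * g) ^ 2 + 11 * s ^ 4))
      (gaussianReal 0 1) := by
  refine (((integrable_shift_sq m s).const_mul (22 * s ^ 2)).add
    (integrable_const (11 * s ^ 4))).mono' ?_ (ae_of_all _ fun g => ?_)
  · exact ((continuous_log_correction s).comp
      (by fun_prop : Continuous fun g : ℝ => m + s * g)).aestronglyMeasurable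
  · exact log_correction_le s (m + s * g)

/-- The average over `g` equals the average over `-g`, so the pointwise bound for the sum of the two
logarithms applies with `x = m s`, `y = s² g` and `τ = s²`. -/
theorem min_le_integral_log_correction (m s : ℝ) :
    min (Real.log 4) (4 * (m * s) ^ 2 + 2 * (s ^ 2) ^ 2) ≤
      ∫ g, Real.log (1 + 22 * s ^ 2 * (m + s * g) ^ 2 + 11 * s ^ 4) ∂(gaussianReal 0 1) := by
  have hI := integrable_log_correction m s
  have hI' : Integrable (fun g => Real.log (1 + 22 * s ^ 2 * (m + s * -g) ^ 2 + 11 * s ^ 4))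
      (gaussianReal 0 1) := by
    have := integrable_log_correction m (-s)
    refine this.congr (ae_of_all _ fun g => ?_)
    simp only []
    congr 1
    ring
  have hs := integral_neg_gaussianReal
    (fun g => Real.log (1 + 22 * s ^ 2 * (m + s * g) ^ 2 + 11 * s ^ 4)) 1
  have hsum := integral_add hI hI'
  rw [hs] at hsum
  have hlow : 2 * min (Real.log 4) (4 * (m * s) ^ 2 + 2 * (s ^ 2) ^ 2) ≤
      ∫ g, (Real.log (1 + 22 * s ^ 2 * (m + s * g) ^ 2 + 11 * s ^ 4) +
        Real.log (1 + 22 * s ^ 2 * (m + s * -g) ^ 2 + 11 * s ^ 4)) ∂(gaussianReal 0 1) := by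
    have := integral_mono (μ := gaussianReal 0 1) (integrable_const
      (2 * min (Real.log 4) (4 * (m * s) ^ 2 + 2 * (s ^ 2) ^ 2))) (hI.add hI') (fun g => ?_)
    · simpa using this
    · have := min_le_half_log_add_log (m * s) (s ^ 2 * g) (s ^ 2)
      refine this.trans_eq ?_
      simp only [Pi.add_apply]
      congr 2 <;> ring
  linarith

theorem integrable_psi_comp {f : ℝ → ℝ} (hf : Continuous f) (μ : Measure ℝ)
    [IsProbabilityMeasure μ] : Integrable (fun g => psi (f g)) μ :=
  Integrable.of_bound (continuous_psi.comp hf).aestronglyMeasurable (Real.log 2)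
    (ae_of_all _ fun _ => abs_psi_le _)

/-- The smoothed argument has mean `e (m² - lam)`, because of the recentering by `s²`, and its
variance is `4 m² s² + 2 s⁴`; Jensen up to a variance gives one term of the minimum. The other, `log
4 = 2 log 2`, is the oscillation of `psi`. -/
theorem psi_le_integral_add_min {e : ℝ} (he : e ^ 2 = 1) (lam m s : ℝ) :
    psi (e * (m ^ 2 - lam)) ≤
      ∫ g, psi (e * ((m + s * g) ^ 2 - s ^ 2 - lam)) ∂(gaussianReal 0 1) +
        min (Real.log 4) (4 * (m * s) ^ 2 + 2 * (s ^ 2) ^ 2) := by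
  have hcont : Continuous fun g : ℝ => e * ((m + s * g) ^ 2 - s ^ 2 - lam) := by fun_prop
  have hpsi := integrable_psi_comp hcont (gaussianReal 0 1)
  rw [← min_add_add_left]
  refine le_min ?_ ?_
  · have h1 : -Real.log 2 ≤
        ∫ g, psi (e * ((m + s * g) ^ 2 - s ^ 2 - lam)) ∂(gaussianReal 0 1) := by
      have := integral_mono (μ := gaussianReal 0 1) (integrable_const (-Real.log 2)) hpsi
        (fun _ => neg_log_two_le_psi _)
      simpa using this
    have h2 := psi_le_log_two (e * (m ^ 2 - lam))
    have l4 : Real.log 4 = 2 * Real.log 2 := by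
      rw [show (4:ℝ) = 2 ^ 2 by norm_num, Real.log_pow]; norm_num
    linarith
  · have e1 : (fun g : ℝ => e * ((m + s * g) ^ 2 - s ^ 2 - lam)) = fun g =>
        e * (m ^ 2 - s ^ 2 - lam) + e * (2 * m * s) * g + e * s ^ 2 * g ^ 2 + 0 * g ^ 3
          + 0 * g ^ 4 := by
      ext g; ring
    have i1 : Integrable (fun g : ℝ => e * ((m + s * g) ^ 2 - s ^ 2 - lam)) (gaussianReal 0 1) := by
      rw [e1]; exact integrable_quartic_gaussianReal _ _ _ _ _
    have mean : ∫ g, e * ((m + s * g) ^ 2 - s ^ 2 - lam) ∂(gaussianReal 0 1) =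
        e * (m ^ 2 - lam) := by
      rw [e1, integral_quartic_gaussianReal]; ring
    have e2 : (fun g : ℝ => (e * ((m + s * g) ^ 2 - s ^ 2 - lam)) ^ 2) = fun g =>
        (e * (m ^ 2 - s ^ 2 - lam)) ^ 2 + 2 * (e * (m ^ 2 - s ^ 2 - lam)) * (e * (2 * m * s)) * g
          + ((e * (2 * m * s)) ^ 2 + 2 * (e * (m ^ 2 - s ^ 2 - lam)) * (e * s ^ 2)) * g ^ 2
          + 2 * (e * (2 * m * s)) * (e * s ^ 2) * g ^ 3 + (e * s ^ 2) ^ 2 * g ^ 4 := by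
      ext g; ring
    have i2 : Integrable (fun g : ℝ => (e * ((m + s * g) ^ 2 - s ^ 2 - lam)) ^ 2)
        (gaussianReal 0 1) := by
      rw [e2]; exact integrable_quartic_gaussianReal _ _ _ _ _
    have var : ∫ g, (e * ((m + s * g) ^ 2 - s ^ 2 - lam) - e * (m ^ 2 - lam)) ^ 2
        ∂(gaussianReal 0 1) = 4 * (m * s) ^ 2 + 2 * (s ^ 2) ^ 2 := by
      have e3 : (fun g : ℝ => (e * ((m + s * g) ^ 2 - s ^ 2 - lam) - e * (m ^ 2 - lam)) ^ 2) =
          fun g => s ^ 4 + (-4 * m * s ^ 3) * g + (4 * m ^ 2 * s ^ 2 - 2 * s ^ 4) * g ^ 2 +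
            4 * m * s ^ 3 * g ^ 3 + s ^ 4 * g ^ 4 := by
        ext g
        have : (e * ((m + s * g) ^ 2 - s ^ 2 - lam) - e * (m ^ 2 - lam)) ^ 2 =
          e ^ 2 * ((m + s * g) ^ 2 - s ^ 2 - m ^ 2) ^ 2 := by ring
        rw [this, he]; ring
      rw [e3, integral_quartic_gaussianReal]; ring
    have := psi_integral_le i1 i2
    rwa [mean, var] at this

/-- This trades `psi` in one direction for an average over Gaussian perturbations, which is what a
PAC-Bayesian inequality can control. -/
theorem psi_le_integral_softPsi {e : ℝ} (he : e ^ 2 = 1) (lam m s : ℝ) :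
    psi (e * (m ^ 2 - lam)) ≤ ∫ g, softPsi e lam s (m + s * g) ∂(gaussianReal 0 1) := by
  have hcont : Continuous fun g : ℝ => e * ((m + s * g) ^ 2 - s ^ 2 - lam) := by fun_prop
  unfold softPsi
  rw [integral_add (integrable_psi_comp hcont _) (integrable_log_correction m s)]
  have h1 := psi_le_integral_add_min he lam m s
  have h2 := min_le_integral_log_correction m s
  linarith

/-- In `exp (psi z) (1 + R)` the bound `1 + z + z² / 2` is used for the first term, and `exp (psi z)
≤ 2` for the factor of `R`, so the degree stays equal to four. -/
theorem exp_softPsi_le (e lam s w : ℝ) :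
    Real.exp (softPsi e lam s w) ≤ 1 + e * (w ^ 2 - s ^ 2 - lam) +
      (e * (w ^ 2 - s ^ 2 - lam)) ^ 2 / 2 + (44 * s ^ 2 * w ^ 2 + 22 * s ^ 4) := by
  have hR : 0 ≤ 22 * s ^ 2 * w ^ 2 + 11 * s ^ 4 := by positivity
  unfold softPsi
  rw [Real.exp_add, Real.exp_log (by linarith)]
  have h1 := exp_psi_le (e * (w ^ 2 - s ^ 2 - lam))
  have h2 := exp_psi_le_two (e * (w ^ 2 - s ^ 2 - lam))
  nlinarith

/-! ### Density, translations and marginals of the standard Gaussian measure -/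

theorem integrable_exp_neg_sq_norm (d : ℕ) :
    Integrable fun v : Vec d => Real.exp (-(1 / 2) * ‖v‖ ^ 2) := by
  have h := GaussianFourier.integrable_cexp_neg_mul_sq_norm_add (V := Vec d)
    (b := 1 / 2) (by norm_num) 0 0
  refine h.re.congr (ae_of_all _ fun v => ?_)
  have : (-(1 / 2 : ℂ) * (‖v‖ : ℂ) ^ 2 + 0 * ((inner ℝ (0 : Vec d) v : ℝ) : ℂ)) =
      ((-(1 / 2) * ‖v‖ ^ 2 : ℝ) : ℂ) := by push_cast; ring
  simp only [RCLike.re_to_complex]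
  rw [this, ← Complex.ofReal_exp, Complex.ofReal_re]

/-- The density of the standard Gaussian measure. -/
noncomputable def gaussianDensity {d : ℕ} (v : Vec d) : ℝ :=
  (∫ u : Vec d, Real.exp (-(1 / 2) * ‖u‖ ^ 2))⁻¹ * Real.exp (-(1 / 2) * ‖v‖ ^ 2)

theorem gaussianDensity_nonneg {d : ℕ} (v : Vec d) : 0 ≤ gaussianDensity v := by
  unfold gaussianDensity
  exact mul_nonneg (inv_nonneg.2 (integral_nonneg fun _ => (Real.exp_pos _).le)) (Real.exp_pos _).le

theorem measurable_gaussianDensity {d : ℕ} : Measurable (gaussianDensity (d := d)) := by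
  unfold gaussianDensity; fun_prop

theorem integrable_gaussianDensity (d : ℕ) : Integrable (gaussianDensity (d := d)) :=
  (integrable_exp_neg_sq_norm d).const_mul _

/-- Both measures have the same characteristic function. The density makes the translation formula a
change of variables for Lebesgue measure. -/
theorem stdGaussian_eq_withDensity (d : ℕ) :
    stdGaussian (Vec d) =
      (volume : Measure (Vec d)).withDensity fun v => ENNReal.ofReal (gaussianDensity v) := by
  have hfin : IsFiniteMeasure
      ((volume : Measure (Vec d)).withDensity fun v => ENNReal.ofReal (gaussianDensity v)) :=
    isFiniteMeasure_withDensity_ofReal (integrable_gaussianDensity d).2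
  refine Measure.ext_of_charFun (E := Vec d) ?_
  ext t
  rw [charFun_stdGaussian, charFun_apply,
    integral_withDensity_eq_integral_toReal_smul (by
      exact measurable_gaussianDensity.ennreal_ofReal) (ae_of_all _ fun _ => ENNReal.ofReal_lt_top)]
  have h := GaussianFourier.integral_cexp_neg_mul_sq_norm_add (V := Vec d)
    (b := 1 / 2) (by norm_num) Complex.I t
  have h0 := GaussianFourier.integral_rexp_neg_mul_sq_norm (V := Vec d) (b := 1 / 2) (by norm_num)
  have e : ∀ v : Vec d, (ENNReal.ofReal (gaussianDensity v)).toReal •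
      Complex.exp (((inner ℝ v t : ℝ) : ℂ) * Complex.I) =
      (((∫ u : Vec d, Real.exp (-(1 / 2) * ‖u‖ ^ 2))⁻¹ : ℝ) : ℂ) *
        Complex.exp (-(1 / 2) * (‖v‖ : ℂ) ^ 2 + Complex.I * ((inner ℝ t v : ℝ) : ℂ)) := by
    intro v
    rw [ENNReal.toReal_ofReal (gaussianDensity_nonneg v), gaussianDensity, Complex.real_smul,
      Complex.exp_add, Complex.ofReal_mul, Complex.ofReal_exp, real_inner_comm]
    push_cast
    ring_nf
  simp_rw [e]
  rw [integral_const_mul, h, h0]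
  have hpos : (0:ℝ) < Real.pi / (1 / 2) := by positivity
  rw [Complex.ofReal_inv, Complex.ofReal_cpow hpos.le]
  push_cast
  rw [← mul_assoc, inv_mul_cancel₀, one_mul, Complex.I_sq]
  · congr 1; ring
  · refine Complex.cpow_ne_zero_iff.2 (Or.inl ?_)
    have : (Real.pi : ℂ) ≠ 0 := by exact_mod_cast Real.pi_ne_zero
    simp

/-- The Cameron–Martin formula for the standard Gaussian measure. -/
theorem lintegral_stdGaussian_shift {d : ℕ} {f : Vec d → ENNReal} (hf : Measurable f) (ξ : Vec d) :
    ∫⁻ v, f v ∂(stdGaussian (Vec d)) =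
      ∫⁻ v, f (ξ + v) * ENNReal.ofReal (Real.exp (-inner ℝ ξ v - ‖ξ‖ ^ 2 / 2))
        ∂(stdGaussian (Vec d)) := by
  have hm := (measurable_gaussianDensity (d := d)).ennreal_ofReal
  rw [stdGaussian_eq_withDensity, lintegral_withDensity_eq_lintegral_mul _ hm hf,
    lintegral_withDensity_eq_lintegral_mul _ hm (by fun_prop),
    ← lintegral_add_left_eq_self _ ξ]
  refine lintegral_congr fun v => ?_
  simp only [Pi.mul_apply]
  rw [mul_comm (f (ξ + v)), ← mul_assoc, ← ENNReal.ofReal_mul (gaussianDensity_nonneg v)]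
  congr 2
  rw [gaussianDensity, gaussianDensity, mul_assoc, ← Real.exp_add, norm_add_sq_real]
  ring_nf

theorem stdGaussian_map_inner {d : ℕ} (y : Vec d) :
    (stdGaussian (Vec d)).map (fun v => inner ℝ v y) =
      (gaussianReal 0 1).map (fun g => ‖y‖ * g) := by
  have h := IsGaussian.map_eq_gaussianReal (μ := stdGaussian (Vec d)) (innerSL ℝ y)
  rw [integral_strongDual_stdGaussian, variance_dual_stdGaussian, innerSL_apply_norm] at h
  rw [gaussianReal_map_const_mul]
  have e : (fun v : Vec d => inner ℝ v y) = ⇑(innerSL ℝ y) := by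
    ext v; rw [innerSL_apply_apply, real_inner_comm]
  rw [e, h]
  congr 1
  · simp
  · ext; simp

theorem integral_stdGaussian_inner {d : ℕ} (y : Vec d) {f : ℝ → ℝ} (hf : Measurable f) :
    ∫ v, f (inner ℝ v y) ∂(stdGaussian (Vec d)) = ∫ g, f (‖y‖ * g) ∂(gaussianReal 0 1) := by
  rw [← integral_map (f := f) (φ := fun v : Vec d => inner ℝ v y) (by fun_prop)
    hf.aestronglyMeasurable, stdGaussian_map_inner,
    integral_map (by fun_prop) hf.aestronglyMeasurable]

theorem integrable_stdGaussian_inner_iff {d : ℕ} (y : Vec d) {f : ℝ → ℝ} (hf : Measurable f) :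
    Integrable (fun v => f (inner ℝ v y)) (stdGaussian (Vec d)) ↔
      Integrable (fun g => f (‖y‖ * g)) (gaussianReal 0 1) := by
  rw [show (fun v : Vec d => f (inner ℝ v y)) = f ∘ (fun v : Vec d => inner ℝ v y) from rfl,
    ← integrable_map_measure hf.aestronglyMeasurable (by fun_prop), stdGaussian_map_inner,
    integrable_map_measure hf.aestronglyMeasurable (by fun_prop)]
  rfl

theorem integrable_inner_stdGaussian {d : ℕ} (y : Vec d) :
    Integrable (fun v => inner ℝ v y) (stdGaussian (Vec d)) := by
  refine (integrable_stdGaussian_inner_iff y (f := fun x => x) measurable_id).2 ?_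
  simpa using (integrable_pow_gaussianReal 1 1).const_mul ‖y‖

theorem integral_inner_stdGaussian {d : ℕ} (y : Vec d) :
    ∫ v, inner ℝ v y ∂(stdGaussian (Vec d)) = 0 := by
  rw [integral_stdGaussian_inner y (f := fun x => x) measurable_id]
  exact integral_odd_gaussianReal (by simp) 1

/-! ### The PAC-Bayesian inequality -/

/-- A PAC-Bayesian deviation bound, with a standard Gaussian prior and Gaussian posteriors with
identity covariance. -/
theorem exists_event_pacBayes {Ω : Type*} [MeasurableSpace Ω] {Pr : Measure Ω}
    [IsProbabilityMeasure Pr] {d n : ℕ} {Y : Fin n → Ω → Vec d} (hY : ∀ i, Measurable (Y i))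
    {Q : Measure (Vec d)} (hQ : ∀ i, Pr.map (Y i) = Q) (hind : iIndepFun Y Pr)
    {F : Vec d → Vec d → ℝ} (hF : Measurable (Function.uncurry F))
    {K : Vec d → ℝ} (hK : Measurable K)
    (hFK : ∀ ξ, ∫⁻ y, ENNReal.ofReal (Real.exp (F ξ y)) ∂Q ≤ ENNReal.ofReal (Real.exp (K ξ)))
    {ε : ℝ} (hε : 0 < ε) :
    ∃ B : Set Ω, MeasurableSet B ∧ Pr Bᶜ ≤ ENNReal.ofReal ε ∧ ∀ ω ∈ B, ∀ ξ : Vec d,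
      Integrable (fun v => ∑ i, F (ξ + v) (Y i ω) - n * K (ξ + v)) (stdGaussian (Vec d)) →
      ∫ v, (∑ i, F (ξ + v) (Y i ω) - n * K (ξ + v)) ∂(stdGaussian (Vec d)) ≤
        ‖ξ‖ ^ 2 / 2 + Real.log ε⁻¹ := by
  set γ := stdGaussian (Vec d)
  have hFi : ∀ i, Measurable fun p : Ω × Vec d => F p.2 (Y i p.1) := fun i =>
    hF.comp (measurable_snd.prodMk ((hY i).comp measurable_fst))
  have hLm : Measurable fun p : Ω × Vec d => ∑ i, F p.2 (Y i p.1) - n * K p.2 :=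
    (Finset.measurable_sum _ fun i _ => hFi i).sub ((hK.comp measurable_snd).const_mul _)
  have hEm : Measurable fun p : Ω × Vec d =>
      ENNReal.ofReal (Real.exp (∑ i, F p.2 (Y i p.1) - n * K p.2)) :=
    (Real.measurable_exp.comp hLm).ennreal_ofReal
  set S : Ω → ENNReal := fun ω =>
    ∫⁻ v, ENNReal.ofReal (Real.exp (∑ i, F v (Y i ω) - n * K v)) ∂γ with hS
  have hSm : Measurable S := hEm.lintegral_prod_right'
  -- For a fixed direction, independence factorizes the expectation into at most `exp (K v) ^ n`,
  -- which the normalization cancels. Tonelli then averages over the prior.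
  have hS1 : ∫⁻ ω, S ω ∂Pr ≤ 1 := by
    rw [hS, lintegral_lintegral_swap hEm.aemeasurable]
    have hle : ∀ v, ∫⁻ ω, ENNReal.ofReal (Real.exp (∑ i, F v (Y i ω) - n * K v)) ∂Pr ≤ 1 := by
      intro v
      have hFv : Measurable fun y => ENNReal.ofReal (Real.exp (F v y)) :=
        (Real.measurable_exp.comp (hF.comp measurable_prodMk_left)).ennreal_ofReal
      have e : ∀ ω, ENNReal.ofReal (Real.exp (∑ i, F v (Y i ω) - n * K v)) =
          ENNReal.ofReal (Real.exp (-(n * K v))) *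
            ∏ i, ENNReal.ofReal (Real.exp (F v (Y i ω))) := by
        intro ω
        rw [← ENNReal.ofReal_prod_of_nonneg fun i _ => (Real.exp_pos _).le,
          ← ENNReal.ofReal_mul (Real.exp_pos _).le, ← Real.exp_sum, ← Real.exp_add]
        congr 2; ring
      simp_rw [e]
      have hFYi : ∀ i, Measurable fun ω => ENNReal.ofReal (Real.exp (F v (Y i ω))) :=
        fun i => hFv.comp (hY i)
      rw [lintegral_const_mul _ (Finset.measurable_fun_prod _ fun i _ => hFYi i),
        lintegral_prod_eq_prod_lintegral_of_indepFun Finset.univ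
          (fun i ω => ENNReal.ofReal (Real.exp (F v (Y i ω))))
          (hind.comp (fun _ y => ENNReal.ofReal (Real.exp (F v y))) fun _ => hFv)
          hFYi]
      have hi : ∀ i, ∫⁻ ω, ENNReal.ofReal (Real.exp (F v (Y i ω))) ∂Pr ≤
          ENNReal.ofReal (Real.exp (K v)) := by
        intro i
        rw [← lintegral_map hFv (hY i), hQ i]
        exact hFK v
      calc _ ≤ ENNReal.ofReal (Real.exp (-(n * K v))) *
            ∏ _i : Fin n, ENNReal.ofReal (Real.exp (K v)) := by
            gcongr with i
            exact hi i
        _ = 1 := by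
            rw [← ENNReal.ofReal_prod_of_nonneg fun i _ => (Real.exp_pos _).le,
              ← ENNReal.ofReal_mul (Real.exp_pos _).le, ← Real.exp_sum, ← Real.exp_add]
            simp
    calc _ ≤ ∫⁻ _v, 1 ∂γ := lintegral_mono hle
      _ = 1 := by simp [γ]
  -- Markov's inequality for `S`. The event does not depend on `ξ`, which makes the bound uniform.
  refine ⟨{ω | S ω < ENNReal.ofReal ε⁻¹}, hSm measurableSet_Iio, ?_, ?_⟩
  · have hc : {ω | S ω < ENNReal.ofReal ε⁻¹}ᶜ = {ω | ENNReal.ofReal ε⁻¹ ≤ S ω} := by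
      ext ω; simp
    rw [hc]
    have hm := meas_ge_le_lintegral_div hSm.aemeasurable (μ := Pr) (ε := ENNReal.ofReal ε⁻¹)
      (by simpa using hε) ENNReal.ofReal_ne_top
    refine hm.trans ((ENNReal.div_le_div_right hS1 _).trans_eq ?_)
    rw [ENNReal.ofReal_inv_of_pos hε, one_div, inv_inv]
  · intro ω hω ξ hint
    set L : Vec d → ℝ := fun v => ∑ i, F v (Y i ω) - n * K v with hL
    have hLω : Measurable L := hLm.comp measurable_prodMk_left
    have hint' : Integrable (fun v => L (ξ + v)) γ := hint
    have hinner : Integrable (fun v => inner ℝ ξ v) γ := by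
      simpa [real_inner_comm] using integrable_inner_stdGaussian ξ
    have hinner0 : ∫ v, inner ℝ ξ v ∂γ = 0 := by
      simpa [real_inner_comm] using integral_inner_stdGaussian ξ
    -- After the translation by `ξ`, the exponent contains a centered linear term and the constant
    -- `-‖ξ‖² / 2`. Jensen's inequality for `exp` turns this constant into the entropy cost.
    have hsh : S ω = ∫⁻ v, ENNReal.ofReal
        (Real.exp (L (ξ + v) - inner ℝ ξ v - ‖ξ‖ ^ 2 / 2)) ∂γ := by
      have : S ω = ∫⁻ v, ENNReal.ofReal (Real.exp (L v)) ∂γ := rfl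
      have hLe : Measurable fun v => ENNReal.ofReal (Real.exp (L v)) :=
        (Real.measurable_exp.comp hLω).ennreal_ofReal
      rw [this, lintegral_stdGaussian_shift hLe ξ]
      refine lintegral_congr fun v => ?_
      rw [← ENNReal.ofReal_mul (Real.exp_pos _).le, ← Real.exp_add]
      congr 2; ring
    have hsub : Integrable (fun v => L (ξ + v) - inner ℝ ξ v) γ := hint'.sub hinner
    have hI : Integrable (fun v => L (ξ + v) - inner ℝ ξ v - ‖ξ‖ ^ 2 / 2) γ :=
      hsub.sub (integrable_const _)
    have hSlt : S ω < ENNReal.ofReal ε⁻¹ := hω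
    have hexp : Integrable (fun v => Real.exp (L (ξ + v) - inner ℝ ξ v - ‖ξ‖ ^ 2 / 2)) γ := by
      refine ⟨Real.continuous_exp.comp_aestronglyMeasurable hI.1, ?_⟩
      rw [hasFiniteIntegral_iff_ofReal (ae_of_all _ fun _ => (Real.exp_pos _).le), ← hsh]
      exact hSlt.trans ENNReal.ofReal_lt_top
    have hJ := convexOn_exp.map_integral_le (μ := γ)
      (f := fun v => L (ξ + v) - inner ℝ ξ v - ‖ξ‖ ^ 2 / 2) Real.continuous_exp.continuousOn
      isClosed_univ (ae_of_all _ fun _ => Set.mem_univ _) hI hexp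
    have hle : ∫ v, Real.exp (L (ξ + v) - inner ℝ ξ v - ‖ξ‖ ^ 2 / 2) ∂γ ≤ ε⁻¹ := by
      rw [integral_eq_lintegral_of_nonneg_ae (ae_of_all _ fun _ => (Real.exp_pos _).le) hexp.1,
        ← hsh]
      exact ENNReal.toReal_le_of_le_ofReal (by positivity) hSlt.le
    have h3 := (Real.le_log_iff_exp_le (by positivity)).2 (hJ.trans hle)
    rw [integral_sub hsub (integrable_const _), integral_sub hint' hinner, hinner0] at h3
    simp only [integral_const, probReal_univ, smul_eq_mul, one_mul] at h3
    have : ∫ v, L (ξ + v) ∂γ ≤ ‖ξ‖ ^ 2 / 2 + Real.log ε⁻¹ := by linarith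
    exact this

/-! ### The smoothed influence function in Gaussian directions -/

theorem integral_softPsi_stdGaussian {d : ℕ} {e : ℝ} (he : e ^ 2 = 1) (lam : ℝ) (ξ y : Vec d) :
    Integrable (fun v => softPsi e lam ‖y‖ (inner ℝ (ξ + v) y)) (stdGaussian (Vec d)) ∧
    psi (e * (inner ℝ ξ y ^ 2 - lam)) ≤
      ∫ v, softPsi e lam ‖y‖ (inner ℝ (ξ + v) y) ∂(stdGaussian (Vec d)) := by
  have hc : Continuous (softPsi e lam ‖y‖) := by
    unfold softPsi
    exact (continuous_psi.comp (by fun_prop)).add (continuous_log_correction _)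
  have hm : Measurable fun x => softPsi e lam ‖y‖ (inner ℝ ξ y + x) :=
    (hc.comp (by fun_prop)).measurable
  simp_rw [inner_add_left]
  constructor
  · refine (integrable_stdGaussian_inner_iff y hm).2 ?_
    unfold softPsi
    exact (integrable_psi_comp (by fun_prop) _).add (integrable_log_correction _ _)
  · rw [integral_stdGaussian_inner y hm]
    exact psi_le_integral_softPsi he lam _ _

/-- The polynomial that bounds `exp (softPsi e lam s w) - 1`. -/
noncomputable def softPoly (e lam s w : ℝ) : ℝ :=
  e * (w ^ 2 - s ^ 2 - lam) + (w ^ 2 - s ^ 2 - lam) ^ 2 / 2 + (44 * s ^ 2 * w ^ 2 + 22 * s ^ 4)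

theorem exp_softPsi_le_one_add {e : ℝ} (he : e ^ 2 = 1) (lam s w : ℝ) :
    Real.exp (softPsi e lam s w) ≤ 1 + softPoly e lam s w := by
  refine (exp_softPsi_le e lam s w).trans_eq ?_
  unfold softPoly
  rw [mul_pow, he]; ring

theorem neg_one_le_softPoly {e : ℝ} (he : e ^ 2 = 1) (lam s w : ℝ) : -1 ≤ softPoly e lam s w := by
  linarith [exp_softPsi_le_one_add he lam s w, Real.exp_pos (softPsi e lam s w)]

/-- Half of the variance contributes `2 m² s² + s⁴`, with `m = ⟨ξ, y⟩` and `s = ‖y‖`, and the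
correction contributes `44 m² s² + (44 + 22) s⁴`. Hence `46` and `67`. -/
theorem integral_softPoly_stdGaussian {d : ℕ} (e lam : ℝ) (ξ y : Vec d) :
    Integrable (fun v => softPoly e lam ‖y‖ (inner ℝ (ξ + v) y)) (stdGaussian (Vec d)) ∧
    ∫ v, softPoly e lam ‖y‖ (inner ℝ (ξ + v) y) ∂(stdGaussian (Vec d)) =
      e * (inner ℝ ξ y ^ 2 - lam) + (inner ℝ ξ y ^ 2 - lam) ^ 2 / 2 +
        46 * (inner ℝ ξ y ^ 2 * ‖y‖ ^ 2) + 67 * ‖y‖ ^ 4 := by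
  have hm : Measurable fun x => softPoly e lam ‖y‖ (inner ℝ ξ y + x) := by
    unfold softPoly; fun_prop
  simp_rw [inner_add_left]
  set m : ℝ := inner ℝ ξ y
  set s := ‖y‖
  have ex : (fun g : ℝ => softPoly e lam s (m + s * g)) = fun g =>
      (e * (m ^ 2 - s ^ 2 - lam) + (m ^ 2 - s ^ 2 - lam) ^ 2 / 2 + 44 * s ^ 2 * m ^ 2 + 22 * s ^ 4)
      + (2 * e * m * s + 2 * (m ^ 2 - s ^ 2 - lam) * m * s + 88 * s ^ 3 * m) * g
      + (e * s ^ 2 + (m ^ 2 - s ^ 2 - lam) * s ^ 2 + 2 * m ^ 2 * s ^ 2 + 44 * s ^ 4) * g ^ 2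
      + (2 * m * s ^ 3) * g ^ 3 + (s ^ 4 / 2) * g ^ 4 := by
    ext g; unfold softPoly; ring
  constructor
  · refine (integrable_stdGaussian_inner_iff y hm).2 ?_
    change Integrable (fun g : ℝ => softPoly e lam s (m + s * g)) _
    rw [ex]
    exact integrable_quartic_gaussianReal _ _ _ _ _
  · rw [integral_stdGaussian_inner y hm]
    change ∫ g : ℝ, softPoly e lam s (m + s * g) ∂_ = _
    rw [ex, integral_quartic_gaussianReal]
    ring

/-! ### Uniform deviations under a fourth moment -/

section moments

variable {d : ℕ} {Q : Measure (Vec d)}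

theorem integrable_norm_sq_of_pow_four [IsProbabilityMeasure Q]
    (hQ : Integrable (fun y : Vec d => ‖y‖ ^ 4) Q) :
    Integrable (fun y : Vec d => ‖y‖ ^ 2) Q := by
  refine ((integrable_const (1:ℝ)).add hQ).mono' (by fun_prop) (ae_of_all _ fun y => ?_)
  rw [Real.norm_of_nonneg (by positivity)]
  simp only [Pi.add_apply]
  nlinarith [sq_nonneg (‖y‖ ^ 2 - 1)]

theorem inner_sq_le (ξ y : Vec d) : inner ℝ ξ y ^ 2 ≤ ‖ξ‖ ^ 2 * ‖y‖ ^ 2 := by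
  rw [← mul_pow]
  exact sq_le_sq' (neg_le_of_abs_le (abs_real_inner_le_norm ξ y)) (real_inner_le_norm ξ y)

theorem integrable_inner_sq [IsProbabilityMeasure Q]
    (hQ : Integrable (fun y : Vec d => ‖y‖ ^ 4) Q) (ξ : Vec d) :
    Integrable (fun y : Vec d => inner ℝ ξ y ^ 2) Q := by
  refine ((integrable_norm_sq_of_pow_four hQ).const_mul (‖ξ‖ ^ 2)).mono' (by fun_prop)
    (ae_of_all _ fun y => ?_)
  rw [Real.norm_of_nonneg (by positivity)]
  exact inner_sq_le ξ y

theorem integrable_inner_sq_mul_norm_sq (hQ : Integrable (fun y : Vec d => ‖y‖ ^ 4) Q)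
    (ξ : Vec d) : Integrable (fun y : Vec d => inner ℝ ξ y ^ 2 * ‖y‖ ^ 2) Q := by
  refine (hQ.const_mul (‖ξ‖ ^ 2)).mono' (by fun_prop) (ae_of_all _ fun y => ?_)
  rw [Real.norm_of_nonneg (by positivity)]
  nlinarith [inner_sq_le ξ y, sq_nonneg ‖y‖]

theorem integrable_inner_pow_four (hQ : Integrable (fun y : Vec d => ‖y‖ ^ 4) Q) (ξ : Vec d) :
    Integrable (fun y : Vec d => inner ℝ ξ y ^ 4) Q := by
  refine (hQ.const_mul (‖ξ‖ ^ 4)).mono' (by fun_prop) (ae_of_all _ fun y => ?_)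
  rw [Real.norm_of_nonneg (by positivity)]
  have := inner_sq_le ξ y
  calc inner ℝ ξ y ^ 4 = (inner ℝ ξ y ^ 2) ^ 2 := by ring
    _ ≤ (‖ξ‖ ^ 2 * ‖y‖ ^ 2) ^ 2 := by gcongr
    _ = _ := by ring

theorem integral_smoothed_moments [IsProbabilityMeasure Q]
    (hQ : Integrable (fun y : Vec d => ‖y‖ ^ 4) Q)
    (e lam : ℝ) (ξ : Vec d) :
    Integrable (fun y : Vec d => e * (inner ℝ ξ y ^ 2 - lam) + (inner ℝ ξ y ^ 2 - lam) ^ 2 / 2 +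
        46 * (inner ℝ ξ y ^ 2 * ‖y‖ ^ 2) + 67 * ‖y‖ ^ 4) Q ∧
    ∫ y, (e * (inner ℝ ξ y ^ 2 - lam) + (inner ℝ ξ y ^ 2 - lam) ^ 2 / 2 +
        46 * (inner ℝ ξ y ^ 2 * ‖y‖ ^ 2) + 67 * ‖y‖ ^ 4) ∂Q =
      e * (∫ y, inner ℝ ξ y ^ 2 ∂Q - lam) +
      (∫ y, inner ℝ ξ y ^ 4 ∂Q - 2 * lam * ∫ y, inner ℝ ξ y ^ 2 ∂Q + lam ^ 2) / 2 +
      46 * ∫ y, inner ℝ ξ y ^ 2 * ‖y‖ ^ 2 ∂Q + 67 * ∫ y, ‖y‖ ^ 4 ∂Q := by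
  have h2 := integrable_inner_sq hQ ξ
  have h4 := integrable_inner_pow_four hQ ξ
  have h22 := integrable_inner_sq_mul_norm_sq hQ ξ
  have ex : (fun y : Vec d => e * (inner ℝ ξ y ^ 2 - lam) + (inner ℝ ξ y ^ 2 - lam) ^ 2 / 2 +
        46 * (inner ℝ ξ y ^ 2 * ‖y‖ ^ 2) + 67 * ‖y‖ ^ 4) = fun y =>
      (-e * lam + lam ^ 2 / 2) + (e - lam) * inner ℝ ξ y ^ 2 + 1 / 2 * inner ℝ ξ y ^ 4 +
        46 * (inner ℝ ξ y ^ 2 * ‖y‖ ^ 2) + 67 * ‖y‖ ^ 4 := by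
    ext y; ring
  have i1 : Integrable (fun y : Vec d =>
      (-e * lam + lam ^ 2 / 2) + (e - lam) * inner ℝ ξ y ^ 2) Q :=
    (integrable_const _).add (h2.const_mul _)
  have i2 : Integrable (fun y : Vec d => (-e * lam + lam ^ 2 / 2) + (e - lam) * inner ℝ ξ y ^ 2
      + 1 / 2 * inner ℝ ξ y ^ 4) Q := i1.add (h4.const_mul _)
  have i3 : Integrable (fun y : Vec d => (-e * lam + lam ^ 2 / 2) + (e - lam) * inner ℝ ξ y ^ 2
      + 1 / 2 * inner ℝ ξ y ^ 4 + 46 * (inner ℝ ξ y ^ 2 * ‖y‖ ^ 2)) Q := i2.add (h22.const_mul _)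
  rw [ex]
  refine ⟨i3.add (hQ.const_mul _), ?_⟩
  rw [integral_add i3 (hQ.const_mul _), integral_add i2 (h22.const_mul _),
    integral_add i1 (h4.const_mul _), integral_add (integrable_const _) (h2.const_mul _)]
  simp only [integral_const_mul, integral_const, probReal_univ, smul_eq_mul, one_mul]
  ring

theorem integral_integral_softPoly [IsProbabilityMeasure Q]
    (hQ : Integrable (fun y : Vec d => ‖y‖ ^ 4) Q) {e : ℝ}
    (he : e ^ 2 = 1) (lam : ℝ) (ξ : Vec d) :
    Integrable (fun v => ∫ y, softPoly e lam ‖y‖ (inner ℝ (ξ + v) y) ∂Q) (stdGaussian (Vec d)) ∧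
    ∫ v, ∫ y, softPoly e lam ‖y‖ (inner ℝ (ξ + v) y) ∂Q ∂(stdGaussian (Vec d)) =
      e * (∫ y, inner ℝ ξ y ^ 2 ∂Q - lam) +
      (∫ y, inner ℝ ξ y ^ 4 ∂Q - 2 * lam * ∫ y, inner ℝ ξ y ^ 2 ∂Q + lam ^ 2) / 2 +
      46 * ∫ y, inner ℝ ξ y ^ 2 * ‖y‖ ^ 2 ∂Q + 67 * ∫ y, ‖y‖ ^ 4 ∂Q := by
  have hmo := integral_smoothed_moments hQ e lam ξ
  have hprod : Integrable (fun p : Vec d × Vec d => softPoly e lam ‖p.2‖ (inner ℝ (ξ + p.1) p.2))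
      ((stdGaussian (Vec d)).prod Q) := by
    rw [integrable_prod_iff' (by
      unfold softPoly
      exact Continuous.aestronglyMeasurable (by fun_prop))]
    refine ⟨ae_of_all _ fun y => (integral_softPoly_stdGaussian e lam ξ y).1, ?_⟩
    refine (hmo.1.add (integrable_const 2)).mono' ?_ (ae_of_all _ fun y => ?_)
    · refine StronglyMeasurable.aestronglyMeasurable ?_
      refine StronglyMeasurable.integral_prod_left'
        (f := fun p : Vec d × Vec d => ‖softPoly e lam ‖p.2‖ (inner ℝ (ξ + p.1) p.2)‖) ?_
      unfold softPoly
      exact Continuous.stronglyMeasurable (by fun_prop)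
    · have h := integral_softPoly_stdGaussian e lam ξ y
      rw [Real.norm_of_nonneg (integral_nonneg fun _ => norm_nonneg _), Pi.add_apply, ← h.2]
      have h2 : Integrable (fun v => softPoly e lam ‖y‖ (inner ℝ (ξ + v) y) + 2)
          (stdGaussian (Vec d)) := h.1.add (integrable_const 2)
      -- Since `softPoly ≥ -1`, its absolute value is at most `softPoly + 2`, whose Gaussian
      -- integral is explicit. This gives the integrability on the product.
      have := integral_mono h.1.norm h2 fun v => by
        have := neg_one_le_softPoly he lam ‖y‖ (inner ℝ (ξ + v) y)
        simp only [Real.norm_eq_abs]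
        exact abs_le.2 ⟨by linarith, by linarith⟩
      refine this.trans_eq ?_
      rw [integral_add h.1 (integrable_const 2)]
      simp
  refine ⟨hprod.integral_prod_left, ?_⟩
  rw [integral_integral_swap hprod]
  simp_rw [(integral_softPoly_stdGaussian e lam ξ _).2]
  exact hmo.2

theorem integrable_softPoly [IsProbabilityMeasure Q]
    (hQ : Integrable (fun y : Vec d => ‖y‖ ^ 4) Q) (e lam : ℝ)
    (ξ : Vec d) : Integrable (fun y => softPoly e lam ‖y‖ (inner ℝ ξ y)) Q := by
  have ex : (fun y : Vec d => softPoly e lam ‖y‖ (inner ℝ ξ y)) = fun y =>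
      (-e * lam + lam ^ 2 / 2) + (e - lam) * inner ℝ ξ y ^ 2 + (lam - e) * ‖y‖ ^ 2 +
        1 / 2 * inner ℝ ξ y ^ 4 + 43 * (inner ℝ ξ y ^ 2 * ‖y‖ ^ 2) + 45 / 2 * ‖y‖ ^ 4 := by
    ext y; unfold softPoly; ring
  rw [ex]
  exact (((((integrable_const _).add ((integrable_inner_sq hQ ξ).const_mul _)).add
    ((integrable_norm_sq_of_pow_four hQ).const_mul _)).add
    ((integrable_inner_pow_four hQ ξ).const_mul _)).add
    ((integrable_inner_sq_mul_norm_sq hQ ξ).const_mul _)).add (hQ.const_mul _)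

/-- A uniform one-sided deviation bound for the robust empirical energies. -/
theorem exists_event_sum_psi_le {Ω : Type*} [MeasurableSpace Ω] {Pr : Measure Ω}
    [IsProbabilityMeasure Pr] [IsProbabilityMeasure Q] {n : ℕ}
    {Y : Fin n → Ω → Vec d} (hY : ∀ i, Measurable (Y i))
    (hmap : ∀ i, Pr.map (Y i) = Q) (hind : iIndepFun Y Pr)
    (hQ : Integrable (fun y : Vec d => ‖y‖ ^ 4) Q) {e : ℝ} (he : e ^ 2 = 1) (lam : ℝ)
    {ε : ℝ} (hε : 0 < ε) :
    ∃ B : Set Ω, MeasurableSet B ∧ Pr Bᶜ ≤ ENNReal.ofReal ε ∧ ∀ ω ∈ B, ∀ ξ : Vec d,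
      ∑ i, psi (e * (inner ℝ ξ (Y i ω) ^ 2 - lam)) ≤
        n * (e * (∫ y, inner ℝ ξ y ^ 2 ∂Q - lam) +
          (∫ y, inner ℝ ξ y ^ 4 ∂Q - 2 * lam * ∫ y, inner ℝ ξ y ^ 2 ∂Q + lam ^ 2) / 2 +
          46 * ∫ y, inner ℝ ξ y ^ 2 * ‖y‖ ^ 2 ∂Q + 67 * ∫ y, ‖y‖ ^ 4 ∂Q) +
        (‖ξ‖ ^ 2 / 2 + Real.log ε⁻¹) := by
  have hpoly : Continuous fun p : Vec d × Vec d => softPoly e lam ‖p.2‖ (inner ℝ p.1 p.2) := by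
    unfold softPoly; fun_prop
  have hsoft : Measurable (Function.uncurry fun ξ y : Vec d =>
      softPsi e lam ‖y‖ (inner ℝ ξ y)) := by
    unfold softPsi Function.uncurry
    refine (continuous_psi.measurable.comp (by fun_prop)).add ?_
    exact Real.measurable_log.comp (by fun_prop)
  have hK : Measurable fun ξ => ∫ y, softPoly e lam ‖y‖ (inner ℝ ξ y) ∂Q :=
    (hpoly.stronglyMeasurable.integral_prod_right).measurable
  -- The log-Laplace transform is bounded by the mean of `softPoly`: pointwise `exp softPsi ≤ 1 +
  -- softPoly`, and then `1 + K ≤ exp K`.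
  obtain ⟨B, hBm, hB, hBω⟩ := exists_event_pacBayes hY hmap hind
    (F := fun ξ y => softPsi e lam ‖y‖ (inner ℝ ξ y)) hsoft hK (fun ξ => by
      have hi := integrable_softPoly hQ e lam ξ
      have hi1 : Integrable (fun y => 1 + softPoly e lam ‖y‖ (inner ℝ ξ y)) Q :=
        (integrable_const 1).add hi
      calc ∫⁻ y, ENNReal.ofReal (Real.exp (softPsi e lam ‖y‖ (inner ℝ ξ y))) ∂Q
          ≤ ∫⁻ y, ENNReal.ofReal (1 + softPoly e lam ‖y‖ (inner ℝ ξ y)) ∂Q :=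
            lintegral_mono fun y => ENNReal.ofReal_le_ofReal (exp_softPsi_le_one_add he _ _ _)
        _ = ENNReal.ofReal (1 + ∫ y, softPoly e lam ‖y‖ (inner ℝ ξ y) ∂Q) := by
            rw [← ofReal_integral_eq_lintegral_ofReal hi1 (ae_of_all _ fun y => by
              simp only [Pi.zero_apply]
              linarith [neg_one_le_softPoly he lam ‖y‖ (inner ℝ ξ y)]),
              integral_add (integrable_const 1) hi]
            simp
        _ ≤ _ := ENNReal.ofReal_le_ofReal (by
            rw [add_comm]; exact Real.add_one_le_exp _)) hε
  refine ⟨B, hBm, hB, fun ω hω ξ => ?_⟩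
  have hs := fun i => integral_softPsi_stdGaussian he lam ξ (Y i ω)
  have hp := integral_integral_softPoly hQ he lam ξ
  have hsum : Integrable (fun v => ∑ i, softPsi e lam ‖Y i ω‖ (inner ℝ (ξ + v) (Y i ω)))
      (stdGaussian (Vec d)) := integrable_finsetSum _ fun i _ => (hs i).1
  have h := hBω ω hω ξ (hsum.sub (hp.1.const_mul _))
  rw [integral_sub hsum (hp.1.const_mul _), integral_finsetSum _ fun i _ => (hs i).1,
    integral_const_mul, hp.2] at h
  have h2 := Finset.sum_le_sum fun i (_ : i ∈ Finset.univ) => (hs i).2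
  linarith

end moments

/-! ### Quadratic forms in an eigenbasis -/

section quadForm

variable {d : ℕ}

theorem quadForm_eq_inner (H : Matrix (Fin d) (Fin d) ℝ) (θ : Vec d) :
    quadForm H θ = inner ℝ θ (WithLp.toLp 2 (H.mulVec θ.ofLp)) := by
  rw [EuclideanSpace.inner_eq_star_dotProduct, dotProduct_comm]
  simp [quadForm]

theorem inner_mulVec_comm {H : Matrix (Fin d) (Fin d) ℝ} (hH : H.IsSymm) (u v : Vec d) :
    inner ℝ u (WithLp.toLp 2 (H.mulVec v.ofLp)) = inner ℝ (WithLp.toLp 2 (H.mulVec u.ofLp)) v := by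
  rw [EuclideanSpace.inner_eq_star_dotProduct, EuclideanSpace.inner_eq_star_dotProduct]
  simp only [star_trivial]
  rw [dotProduct_comm, Matrix.dotProduct_mulVec, ← Matrix.mulVec_transpose, hH.eq, dotProduct_comm]

theorem mulVec_eigenvectorBasis_toLp {H : Matrix (Fin d) (Fin d) ℝ} (hH : H.IsHermitian)
    (j : Fin d) : WithLp.toLp 2 (H.mulVec (hH.eigenvectorBasis j).ofLp) =
      hH.eigenvalues j • hH.eigenvectorBasis j := by
  rw [hH.mulVec_eigenvectorBasis]; rfl

theorem quadForm_eq_sum_eigenvalues {H : Matrix (Fin d) (Fin d) ℝ} (hH : H.IsHermitian)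
    (θ : Vec d) :
    quadForm H θ = ∑ j, hH.eigenvalues j * inner ℝ (hH.eigenvectorBasis j) θ ^ 2 := by
  have hs : H.IsSymm := by simpa [Matrix.IsHermitian, Matrix.IsSymm] using hH
  rw [quadForm_eq_inner, ← hH.eigenvectorBasis.sum_inner_mul_inner]
  refine Finset.sum_congr rfl fun j _ => ?_
  rw [inner_mulVec_comm hs, mulVec_eigenvectorBasis_toLp, real_inner_smul_left,
    real_inner_comm θ]
  ring

theorem quadForm_eigenvectorBasis {H : Matrix (Fin d) (Fin d) ℝ} (hH : H.IsHermitian)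
    (j : Fin d) : quadForm H (hH.eigenvectorBasis j) = hH.eigenvalues j := by
  rw [quadForm_eq_inner, mulVec_eigenvectorBasis_toLp, real_inner_smul_right,
    real_inner_self_eq_norm_sq, hH.eigenvectorBasis.norm_eq_one]
  ring

end quadForm

/-! ### Energies and the kurtosis bound -/

section energy

variable {d : ℕ} {P : Measure (Vec d)}

theorem integrable_inner_sq_of_memLp (hP : MemLp (fun x : Vec d => x) 2 P) (θ : Vec d) :
    Integrable (fun x : Vec d => inner ℝ θ x ^ 2) P := by
  have h : MemLp (fun x : Vec d => inner ℝ θ x) 2 P := hP.const_inner θ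
  exact h.integrable_sq

theorem energy_nonneg (P : Measure (Vec d)) (θ : Vec d) : 0 ≤ energy P θ :=
  integral_nonneg fun _ => sq_nonneg _

theorem energy_smul (P : Measure (Vec d)) (c : ℝ) (θ : Vec d) :
    energy P (c • θ) = c ^ 2 * energy P θ := by
  unfold energy
  rw [← integral_const_mul]
  congr 1; ext x
  rw [real_inner_smul_left]; ring

theorem quadForm_gramMatrix (hP : MemLp (fun x : Vec d => x) 2 P) (θ : Vec d) :
    quadForm (gramMatrix P) θ = energy P θ := by
  have hij : ∀ i j : Fin d, Integrable (fun x : Vec d => x i * x j) P := by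
    intro i j
    have hi : ∀ i : Fin d, MemLp (fun x : Vec d => x i) 2 P := fun i => by
      have := hP.const_inner (𝕜 := ℝ) (EuclideanSpace.single i 1)
      simpa [EuclideanSpace.inner_single_left] using this
    exact (hi i).integrable_mul (hi j)
  have ex : ∀ x : Vec d, inner ℝ θ x ^ 2 = ∑ i, ∑ j, θ i * θ j * (x i * x j) := by
    intro x
    rw [EuclideanSpace.inner_eq_star_dotProduct, sq]
    simp only [dotProduct, star_trivial, Finset.sum_mul_sum]
    refine Finset.sum_congr rfl fun i _ => Finset.sum_congr rfl fun j _ => ?_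
    ring
  unfold energy
  simp_rw [ex]
  rw [integral_finsetSum _ fun i _ => integrable_finsetSum _ fun j _ => (hij i j).const_mul _]
  simp only [quadForm, dotProduct, Matrix.mulVec, gramMatrix, Matrix.of_apply, Finset.mul_sum]
  refine Finset.sum_congr rfl fun i _ => ?_
  rw [integral_finsetSum _ fun j _ => (hij i j).const_mul _]
  refine Finset.sum_congr rfl fun j _ => ?_
  rw [integral_const_mul]; ring

theorem ae_inner_eq_zero_of_energy_eq_zero (hP : MemLp (fun x : Vec d => x) 2 P) {θ : Vec d}
    (h : energy P θ = 0) : ∀ᵐ x ∂P, inner ℝ θ x = 0 := by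
  have := (integral_eq_zero_iff_of_nonneg (fun x => sq_nonneg (inner ℝ θ x))
    (integrable_inner_sq_of_memLp hP θ)).1 h
  filter_upwards [this] with x hx
  exact pow_eq_zero_iff (two_ne_zero) |>.1 hx

/-- By homogeneity, `θ` is rescaled to energy `1`. If its energy is `0`, then `⟨θ, X⟩ = 0` almost
surely. -/
theorem lintegral_inner_pow_four_le (hP : MemLp (fun x : Vec d => x) 2 P) {κ : ℝ}
    (hκ : kurtosis P ≤ ENNReal.ofReal κ) (θ : Vec d) :
    ∫⁻ x, ENNReal.ofReal (inner ℝ θ x ^ 4) ∂P ≤ ENNReal.ofReal (κ * energy P θ ^ 2) := by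
  rcases (energy_nonneg P θ).eq_or_lt with h0 | h0
  · have : ∫⁻ x, ENNReal.ofReal (inner ℝ θ x ^ 4) ∂P = 0 := by
      rw [lintegral_eq_zero_iff' (by fun_prop)]
      filter_upwards [ae_inner_eq_zero_of_energy_eq_zero hP h0.symm] with x hx
      simp [hx]
    rw [this]; exact zero_le
  · set N := energy P θ
    set c : ℝ := (√N)⁻¹
    have hc : 0 < c := inv_pos.2 (Real.sqrt_pos.2 h0)
    have hc2 : c ^ 2 * N = 1 := by
      rw [inv_pow, Real.sq_sqrt h0.le, inv_mul_cancel₀ h0.ne']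
    have h1 : energy P (c • θ) ≤ 1 := by rw [energy_smul, hc2]
    have h2 : ∫⁻ x, ENNReal.ofReal (inner ℝ (c • θ) x ^ 4) ∂P ≤ ENNReal.ofReal κ :=
      (le_iSup₂ (f := fun (θ : Vec d) (_ : energy P θ ≤ 1) =>
        ∫⁻ x, ENNReal.ofReal (inner ℝ θ x ^ 4) ∂P) (c • θ) h1).trans hκ
    have e : ∀ x : Vec d, ENNReal.ofReal (inner ℝ θ x ^ 4) =
        ENNReal.ofReal (N ^ 2) * ENNReal.ofReal (inner ℝ (c • θ) x ^ 4) := by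
      intro x
      rw [← ENNReal.ofReal_mul (by positivity), real_inner_smul_left]
      congr 1
      calc inner ℝ θ x ^ 4 = (c ^ 2 * N) ^ 2 * inner ℝ θ x ^ 4 := by rw [hc2]; ring
        _ = _ := by ring
    simp_rw [e]
    rw [lintegral_const_mul _ (by fun_prop), mul_comm κ, ENNReal.ofReal_mul (by positivity)]
    gcongr

theorem integral_inner_pow_four_le (hP : MemLp (fun x : Vec d => x) 2 P) {κ : ℝ} (hκ0 : 0 ≤ κ)
    (hκ : kurtosis P ≤ ENNReal.ofReal κ) (θ : Vec d) :
    Integrable (fun x : Vec d => inner ℝ θ x ^ 4) P ∧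
      ∫ x, inner ℝ θ x ^ 4 ∂P ≤ κ * energy P θ ^ 2 := by
  have h := lintegral_inner_pow_four_le hP hκ θ
  have hnn : ∀ x : Vec d, 0 ≤ inner ℝ θ x ^ 4 := fun x => by positivity
  constructor
  · refine ⟨by fun_prop, ?_⟩
    rw [hasFiniteIntegral_iff_ofReal (ae_of_all _ hnn)]
    exact h.trans_lt ENNReal.ofReal_lt_top
  · rw [integral_eq_lintegral_of_nonneg_ae (ae_of_all _ hnn) (by fun_prop)]
    exact ENNReal.toReal_le_of_le_ofReal (by positivity) h

end energy

/-! ### Whitening by the Gram matrix -/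

section whitening

variable {d : ℕ} (P : Measure (Vec d))

/-- The `j`th eigenvector of the Gram matrix. -/
noncomputable def gramVec (j : Fin d) : Vec d :=
  (gramMatrix_isHermitian P).eigenvectorBasis j

/-- The `j`th eigenvalue of the Gram matrix. -/
noncomputable def gramVal (j : Fin d) : ℝ := (gramMatrix_isHermitian P).eigenvalues j

/-- The whitening map, that sends the law `P` to a law whose Gram matrix is an orthogonal
projection. -/
noncomputable def whiten (x : Vec d) : Vec d :=
  WithLp.toLp 2 fun j => inner ℝ ((√(gramVal P j))⁻¹ • gramVec P j) x

/-- The square root of the Gram matrix, in its eigenbasis. -/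
noncomputable def coWhiten (θ : Vec d) : Vec d :=
  WithLp.toLp 2 fun j => √(gramVal P j) * inner ℝ (gramVec P j) θ

/-- The vectors orthogonal to the kernel of the Gram matrix. -/
def gramRange : Set (Vec d) := {x | ∀ j, gramVal P j = 0 → inner ℝ (gramVec P j) x = 0}

variable {P}

theorem measurableSet_gramRange : MeasurableSet (gramRange P) := by
  have : gramRange P = ⋂ j, ⋂ (_ : gramVal P j = 0), {x | inner ℝ (gramVec P j) x = 0} := by
    ext x; simp [gramRange]
  rw [this]
  refine MeasurableSet.iInter fun j => MeasurableSet.iInter fun _ => ?_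
  exact measurableSet_eq_fun (by fun_prop) measurable_const

theorem continuous_whiten : Continuous (whiten P) := by
  unfold whiten; fun_prop

theorem energy_gramVec (hP : MemLp (fun x : Vec d => x) 2 P) (j : Fin d) :
    energy P (gramVec P j) = gramVal P j := by
  rw [← quadForm_gramMatrix hP]
  exact quadForm_eigenvectorBasis _ j

theorem gramVal_nonneg (hP : MemLp (fun x : Vec d => x) 2 P) (j : Fin d) : 0 ≤ gramVal P j := by
  rw [← energy_gramVec hP]; exact energy_nonneg _ _

theorem energy_eq_sum (hP : MemLp (fun x : Vec d => x) 2 P) (θ : Vec d) :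
    energy P θ = ∑ j, gramVal P j * inner ℝ (gramVec P j) θ ^ 2 := by
  rw [← quadForm_gramMatrix hP]
  exact quadForm_eq_sum_eigenvalues _ θ

theorem ae_mem_gramRange (hP : MemLp (fun x : Vec d => x) 2 P) : ∀ᵐ x ∂P, x ∈ gramRange P := by
  simp only [gramRange, Set.mem_ofPred_eq]
  rw [ae_all_iff]
  intro j
  by_cases h : gramVal P j = 0
  · rw [← energy_gramVec hP] at h
    filter_upwards [ae_inner_eq_zero_of_energy_eq_zero hP h] with x hx _ using hx
  · exact ae_of_all _ fun x h' => absurd h' h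

theorem inner_eq_zero_of_mem_gramRange (hP : MemLp (fun x : Vec d => x) 2 P) {x θ : Vec d}
    (hx : x ∈ gramRange P) (hθ : energy P θ = 0) : inner ℝ θ x = 0 := by
  rw [energy_eq_sum hP, Finset.sum_eq_zero_iff_of_nonneg
    fun j _ => mul_nonneg (gramVal_nonneg hP j) (sq_nonneg _)] at hθ
  rw [← (gramMatrix_isHermitian P).eigenvectorBasis.sum_inner_mul_inner]
  refine Finset.sum_eq_zero fun j _ => ?_
  rcases mul_eq_zero.1 (hθ j (Finset.mem_univ j)) with h | h
  · rw [show inner ℝ ((gramMatrix_isHermitian P).eigenvectorBasis j) x = 0 from hx j h, mul_zero]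
  · have : inner ℝ (gramVec P j) θ = 0 := pow_eq_zero_iff two_ne_zero |>.1 h
    rw [real_inner_comm, show inner ℝ ((gramMatrix_isHermitian P).eigenvectorBasis j) θ = 0
      from this, zero_mul]

theorem norm_coWhiten_sq (hP : MemLp (fun x : Vec d => x) 2 P) (θ : Vec d) :
    ‖coWhiten P θ‖ ^ 2 = energy P θ := by
  rw [EuclideanSpace.real_norm_sq_eq, energy_eq_sum hP]
  refine Finset.sum_congr rfl fun j _ => ?_
  simp only [coWhiten]
  rw [mul_pow, Real.sq_sqrt (gramVal_nonneg hP j)]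

theorem inner_coWhiten_whiten (hP : MemLp (fun x : Vec d => x) 2 P) {x : Vec d}
    (hx : x ∈ gramRange P) (θ : Vec d) : inner ℝ (coWhiten P θ) (whiten P x) = inner ℝ θ x := by
  rw [EuclideanSpace.inner_eq_star_dotProduct,
    ← (gramMatrix_isHermitian P).eigenvectorBasis.sum_inner_mul_inner]
  simp only [dotProduct, star_trivial, whiten, coWhiten, real_inner_smul_left]
  refine Finset.sum_congr rfl fun j _ => ?_
  rw [real_inner_comm _ θ]
  change _ = inner ℝ (gramVec P j) θ * inner ℝ (gramVec P j) x
  rcases (gramVal_nonneg hP j).eq_or_lt with h | h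
  · rw [hx j h.symm]; simp
  · have := (Real.sqrt_pos.2 h).ne'
    field_simp

/-- The energy is `1`, except when the eigenvalue is `0`: the inverse is then `0` by convention, and
so is the energy. -/
theorem energy_whiten_le (hP : MemLp (fun x : Vec d => x) 2 P) (j : Fin d) :
    energy P ((√(gramVal P j))⁻¹ • gramVec P j) ≤ 1 := by
  rw [energy_smul, energy_gramVec hP, inv_pow, Real.sq_sqrt (gramVal_nonneg hP j)]
  exact inv_mul_le_one

theorem norm_whiten_sq (x : Vec d) :
    ‖whiten P x‖ ^ 2 = ∑ j, inner ℝ ((√(gramVal P j))⁻¹ • gramVec P j) x ^ 2 := by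
  rw [EuclideanSpace.real_norm_sq_eq]; rfl

/-- Cauchy–Schwarz on the `d` squared coordinates bounds `‖whiten P x‖⁴` by `d` times the sum of
their fourth powers, and each coordinate is a direction of energy at most `1`. -/
theorem integral_norm_whiten_pow_four_le (hP : MemLp (fun x : Vec d => x) 2 P) {κ : ℝ}
    (hκ0 : 0 ≤ κ) (hκ : kurtosis P ≤ ENNReal.ofReal κ) :
    Integrable (fun x => ‖whiten P x‖ ^ 4) P ∧ ∫ x, ‖whiten P x‖ ^ 4 ∂P ≤ κ * d ^ 2 := by
  set w : Fin d → Vec d := fun j => (√(gramVal P j))⁻¹ • gramVec P j with hw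
  have h4 := fun j => integral_inner_pow_four_le hP hκ0 hκ (w j)
  have hle : ∀ x, ‖whiten P x‖ ^ 4 ≤ d * ∑ j, inner ℝ (w j) x ^ 4 := by
    intro x
    have e : ‖whiten P x‖ ^ 4 = (∑ j, inner ℝ (w j) x ^ 2) ^ 2 := by
      rw [← norm_whiten_sq]; ring
    rw [e]
    have := sq_sum_le_card_mul_sum_sq (s := Finset.univ) (f := fun j => inner ℝ (w j) x ^ 2)
    simp only [Finset.card_univ, Fintype.card_fin] at this
    refine this.trans_eq ?_
    congr 1
    exact Finset.sum_congr rfl fun j _ => by ring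
  have hI : Integrable (fun x => d * ∑ j, inner ℝ (w j) x ^ 4) P :=
    (integrable_finsetSum _ fun j _ => (h4 j).1).const_mul _
  have hI4 : Integrable (fun x => ‖whiten P x‖ ^ 4) P := by
    refine hI.mono' ((continuous_whiten.norm.pow 4).aestronglyMeasurable) (ae_of_all _ fun x => ?_)
    rw [Real.norm_of_nonneg (by positivity)]
    exact hle x
  refine ⟨hI4, (integral_mono hI4 hI hle).trans ?_⟩
  rw [integral_const_mul, integral_finsetSum _ fun j _ => (h4 j).1]
  have : ∑ j, ∫ x, inner ℝ (w j) x ^ 4 ∂P ≤ ∑ _j : Fin d, κ := by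
    refine Finset.sum_le_sum fun j _ => (h4 j).2.trans ?_
    exact mul_le_of_le_one_right hκ0 (pow_le_one₀ (energy_nonneg _ _) (energy_whiten_le hP j))
  simp only [Finset.sum_const, Finset.card_univ, Fintype.card_fin, nsmul_eq_mul] at this
  calc _ ≤ (d : ℝ) * (d * κ) := by gcongr
    _ = _ := by ring

/-- Each product of squares is split by the arithmetic-geometric inequality with weight `N = energy
P θ`, which balances the two fourth moments: each contributes at most `κ N / 2`. -/
theorem integral_inner_sq_mul_norm_whiten_sq_le (hP : MemLp (fun x : Vec d => x) 2 P) {κ : ℝ}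
    (hκ0 : 0 ≤ κ) (hκ : kurtosis P ≤ ENNReal.ofReal κ) {θ : Vec d} (hθ : 0 < energy P θ) :
    ∫ x, inner ℝ θ x ^ 2 * ‖whiten P x‖ ^ 2 ∂P ≤ κ * energy P θ * d := by
  set w : Fin d → Vec d := fun j => (√(gramVal P j))⁻¹ • gramVec P j with hw
  set N := energy P θ with hN
  have h4 := fun j => integral_inner_pow_four_le hP hκ0 hκ (w j)
  have hθ4 := integral_inner_pow_four_le hP hκ0 hκ θ
  have hle : ∀ x, inner ℝ θ x ^ 2 * ‖whiten P x‖ ^ 2 ≤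
      ∑ j, (N⁻¹ / 2 * inner ℝ θ x ^ 4 + N / 2 * inner ℝ (w j) x ^ 4) := by
    intro x
    rw [norm_whiten_sq, Finset.mul_sum]
    refine Finset.sum_le_sum fun j _ => ?_
    have h := sq_nonneg (inner ℝ θ x ^ 2 - N * inner ℝ (w j) x ^ 2)
    have e : N⁻¹ / 2 * inner ℝ θ x ^ 4 + N / 2 * inner ℝ (w j) x ^ 4
        - inner ℝ θ x ^ 2 * inner ℝ (w j) x ^ 2 =
        N⁻¹ / 2 * (inner ℝ θ x ^ 2 - N * inner ℝ (w j) x ^ 2) ^ 2 := by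
      field_simp; ring
    have : 0 ≤ N⁻¹ / 2 * (inner ℝ θ x ^ 2 - N * inner ℝ (w j) x ^ 2) ^ 2 := by positivity
    linarith
  have hIj : ∀ j, Integrable
      (fun x => N⁻¹ / 2 * inner ℝ θ x ^ 4 + N / 2 * inner ℝ (w j) x ^ 4) P :=
    fun j => (hθ4.1.const_mul _).add ((h4 j).1.const_mul _)
  have hI := integrable_finsetSum Finset.univ fun j _ => hIj j
  refine (integral_mono_of_nonneg (ae_of_all _ fun x => by positivity) hI
    (ae_of_all _ hle)).trans ?_
  rw [integral_finsetSum _ fun j _ => hIj j]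
  have : ∀ j, ∫ x, (N⁻¹ / 2 * inner ℝ θ x ^ 4 + N / 2 * inner ℝ (w j) x ^ 4) ∂P ≤ κ * N := by
    intro j
    rw [integral_add (hθ4.1.const_mul _) ((h4 j).1.const_mul _), integral_const_mul,
      integral_const_mul]
    have a1 : N⁻¹ / 2 * ∫ x, inner ℝ θ x ^ 4 ∂P ≤ N⁻¹ / 2 * (κ * N ^ 2) := by
      gcongr; exact hθ4.2
    have a2 : N / 2 * ∫ x, inner ℝ (w j) x ^ 4 ∂P ≤ N / 2 * κ := by
      gcongr
      refine (h4 j).2.trans ?_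
      exact mul_le_of_le_one_right hκ0 (pow_le_one₀ (energy_nonneg _ _) (energy_whiten_le hP j))
    have : N⁻¹ / 2 * (κ * N ^ 2) = N / 2 * κ := by field_simp
    linarith
  calc _ ≤ ∑ _j : Fin d, κ * N := Finset.sum_le_sum fun j _ => this j
    _ = _ := by simp; ring

end whitening

/-- A uniform one-sided deviation bound in terms of the energy, with scale `lam` and posterior
precision `β`. -/
theorem exists_event_sum_psi_energy_le {Ω : Type*} [MeasurableSpace Ω] {Pr : Measure Ω}
    [IsProbabilityMeasure Pr] {d n : ℕ} {P : Measure (Vec d)} [IsProbabilityMeasure P]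
    (hP : MemLp (fun x : Vec d => x) 2 P) {κ : ℝ} (hκ0 : 0 ≤ κ)
    (hκ : kurtosis P ≤ ENNReal.ofReal κ)
    {X : Fin n → Ω → Vec d} (hX : ∀ i, Measurable (X i)) (hmap : ∀ i, Pr.map (X i) = P)
    (hind : iIndepFun X Pr) {e : ℝ} (he : e ^ 2 = 1) {lam β : ℝ} (hlam : 0 < lam) (hβ : 0 < β)
    {ε : ℝ} (hε : 0 < ε) :
    ∃ B : Set Ω, MeasurableSet B ∧ Pr Bᶜ ≤ ENNReal.ofReal ε ∧ ∀ ω ∈ B,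
      (∀ i, X i ω ∈ gramRange P) → ∀ θ : Vec d, 0 < energy P θ →
      ∑ i, psi (e * (lam * (inner ℝ θ (X i ω) ^ 2 - 1))) ≤
        n * (e * (lam * (energy P θ - 1)) +
          lam ^ 2 * (κ * energy P θ ^ 2 - 2 * energy P θ + 1) / 2 +
          46 * (lam ^ 2 / β * (κ * energy P θ * d)) + 67 * (lam ^ 2 / β ^ 2 * (κ * d ^ 2))) +
        (β * energy P θ / 2 + Real.log ε⁻¹) := by
  -- The sample is multiplied by `c` and the translation is `ξ = √β • coWhiten P θ`. The inner
  -- product becomes `√lam ⟨θ, x⟩`, the scale of `psi`, while the entropy cost is `β N / 2`. A large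
  -- `β` reduces the perturbation and increases the entropy.
  set c : ℝ := √lam / √β with hc
  have hsl : √lam ^ 2 = lam := Real.sq_sqrt hlam.le
  have hsβ : √β ^ 2 = β := Real.sq_sqrt hβ.le
  have hsβ0 : √β ≠ 0 := (Real.sqrt_pos.2 hβ).ne'
  have hc0 : 0 ≤ c := by positivity
  have hc2 : c ^ 2 = lam / β := by rw [hc, div_pow, hsl, hsβ]
  have hc4 : c ^ 4 = lam ^ 2 / β ^ 2 := by
    rw [show c ^ 4 = (c ^ 2) ^ 2 by ring, hc2, div_pow]
  set T : Vec d → Vec d := fun x => c • whiten P x with hT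
  have hTc : Continuous T := continuous_whiten.const_smul c
  have hTm : Measurable T := hTc.measurable
  have hTn : ∀ x, ‖T x‖ = c * ‖whiten P x‖ := fun x => by
    rw [hT]; simp only [norm_smul, Real.norm_of_nonneg hc0]
  have hQprob : IsProbabilityMeasure (P.map T) := Measure.isProbabilityMeasure_map hTm.aemeasurable
  have hW4 := integral_norm_whiten_pow_four_le hP hκ0 hκ
  have hpow : ∀ x, ‖T x‖ ^ 4 = lam ^ 2 / β ^ 2 * ‖whiten P x‖ ^ 4 := fun x => by
    rw [hTn, mul_pow, hc4]
  have hQ4 : Integrable (fun y : Vec d => ‖y‖ ^ 4) (P.map T) := by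
    rw [integrable_map_measure (by fun_prop) hTm.aemeasurable]
    refine (hW4.1.const_mul (lam ^ 2 / β ^ 2)).congr (ae_of_all _ fun x => ?_)
    exact (hpow x).symm
  obtain ⟨B, hBm, hB, hBω⟩ := exists_event_sum_psi_le (Y := fun i ω => T (X i ω)) (Q := P.map T)
    (fun i => hTm.comp (hX i))
    (fun i => by rw [← hmap i, Measure.map_map hTm (hX i)]; rfl)
    (hind.comp (fun _ => T) fun _ => hTm) hQ4 he lam hε
  refine ⟨B, hBm, hB, fun ω hω hR θ hθ => ?_⟩
  set N := energy P θ with hN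
  have hinner : ∀ x ∈ gramRange P, inner ℝ (√β • coWhiten P θ) (T x) = √lam * inner ℝ θ x := by
    intro x hx
    rw [hT]
    simp only [real_inner_smul_left, real_inner_smul_right]
    rw [inner_coWhiten_whiten hP hx, hc]
    field_simp
  have hae : ∀ᵐ x ∂P, inner ℝ (√β • coWhiten P θ) (T x) = √lam * inner ℝ θ x := by
    filter_upwards [ae_mem_gramRange hP] with x hx using hinner x hx
  have h := hBω ω hω (√β • coWhiten P θ)
  have e1 : ∀ i, inner ℝ (√β • coWhiten P θ) (T (X i ω)) ^ 2 - lam =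
      lam * (inner ℝ θ (X i ω) ^ 2 - 1) := fun i => by
    rw [hinner _ (hR i), mul_pow, hsl]; ring
  simp_rw [e1] at h
  have m2 : ∫ y, inner ℝ (√β • coWhiten P θ) y ^ 2 ∂(P.map T) = lam * N := by
    rw [integral_map hTm.aemeasurable (by fun_prop), hN, energy, ← integral_const_mul]
    refine integral_congr_ae ?_
    filter_upwards [hae] with x hx
    rw [hx, mul_pow, hsl]
  have m4 : ∫ y, inner ℝ (√β • coWhiten P θ) y ^ 4 ∂(P.map T) ≤ lam ^ 2 * (κ * N ^ 2) := by
    rw [integral_map hTm.aemeasurable (by fun_prop)]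
    calc _ = ∫ x, lam ^ 2 * inner ℝ θ x ^ 4 ∂P := by
          refine integral_congr_ae ?_
          filter_upwards [hae] with x hx
          rw [hx, mul_pow, show √lam ^ 4 = (√lam ^ 2) ^ 2 by ring, hsl]
      _ ≤ _ := by
          rw [integral_const_mul]
          gcongr
          exact (integral_inner_pow_four_le hP hκ0 hκ θ).2
  have m22 : ∫ y, inner ℝ (√β • coWhiten P θ) y ^ 2 * ‖y‖ ^ 2 ∂(P.map T) ≤
      lam ^ 2 / β * (κ * N * d) := by
    rw [integral_map hTm.aemeasurable (by fun_prop)]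
    calc _ = ∫ x, lam ^ 2 / β * (inner ℝ θ x ^ 2 * ‖whiten P x‖ ^ 2) ∂P := by
          refine integral_congr_ae ?_
          filter_upwards [hae] with x hx
          rw [hx, mul_pow, hsl, hTn, mul_pow, hc2]
          ring
      _ ≤ _ := by
          rw [integral_const_mul]
          gcongr
          exact integral_inner_sq_mul_norm_whiten_sq_le hP hκ0 hκ hθ
  have m04 : ∫ y, ‖y‖ ^ 4 ∂(P.map T) ≤ lam ^ 2 / β ^ 2 * (κ * d ^ 2) := by
    rw [integral_map hTm.aemeasurable (by fun_prop)]
    simp_rw [hpow]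
    rw [integral_const_mul]
    gcongr
    exact hW4.2
  have hnorm : ‖√β • coWhiten P θ‖ ^ 2 = β * N := by
    rw [norm_smul, mul_pow, norm_coWhiten_sq hP, Real.norm_of_nonneg (Real.sqrt_nonneg _), hsβ]
  rw [m2, hnorm] at h
  refine h.trans ?_
  refine add_le_add (mul_le_mul_of_nonneg_left ?_ (Nat.cast_nonneg n)) le_rfl
  nlinarith

/-! ### Tuning of the parameters -/

/-- The part of `mu` that is due to the fluctuations of the energy. -/
noncomputable def muVar (κ ε : ℝ) (n d : ℕ) : ℝ := √(2 * (κ - 1) / n * logTerm ε d)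

/-- The part of `mu` that is due to the Gaussian perturbation. -/
noncomputable def muPert (κ : ℝ) (n d : ℕ) : ℝ := 6.81 * √(2 * κ * d / n)

theorem mu_eq (κ ε : ℝ) (n d : ℕ) : mu κ ε n d = muVar κ ε n d + muPert κ n d := rfl

theorem logTerm_pos {ε : ℝ} (hε : 0 < ε) (hε1 : ε < 1) (d : ℕ) : 0 < logTerm ε d := by
  have : 0 < Real.log ε⁻¹ := Real.log_pos ((one_lt_inv₀ hε).2 hε1)
  unfold logTerm; positivity

section parameters

variable {κ ε : ℝ} {n d : ℕ}

theorem scale_pos (hκ : 1 < κ) (hn : 0 < n) (hL : 0 < logTerm ε d) : 0 < scale κ ε n d := by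
  have : (0:ℝ) < n := by exact_mod_cast hn
  have : 0 < κ - 1 := by linarith
  exact Real.sqrt_pos.2 (by positivity)

theorem muVar_eq (hκ : 1 < κ) (hn : 0 < n) :
    muVar κ ε n d = scale κ ε n d * (κ - 1) := by
  have hn' : (0:ℝ) < n := by exact_mod_cast hn
  have hk : 0 < κ - 1 := by linarith
  unfold muVar scale
  rw [← Real.sqrt_sq hk.le, ← Real.sqrt_mul' _ (sq_nonneg _), Real.sqrt_sq hk.le]
  congr 1
  field_simp

theorem logTerm_eq (hκ : 1 < κ) (hn : 0 < n) (hL : 0 < logTerm ε d) :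
    logTerm ε d = n * scale κ ε n d * muVar κ ε n d / 2 := by
  have hn' : (0:ℝ) < n := by exact_mod_cast hn
  have hk : 0 < κ - 1 := by linarith
  rw [muVar_eq hκ hn]
  have : scale κ ε n d ^ 2 = 2 / ((κ - 1) * n) * logTerm ε d := Real.sq_sqrt (by positivity)
  calc logTerm ε d = n * (κ - 1) / 2 * (2 / ((κ - 1) * n) * logTerm ε d) := by field_simp
    _ = _ := by rw [← this]; ring

theorem muPert_pos (hκ : 1 < κ) (hn : 0 < n) (hd : 0 < d) : 0 < muPert κ n d := by
  have hn' : (0:ℝ) < n := by exact_mod_cast hn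
  have hd' : (0:ℝ) < d := by exact_mod_cast hd
  have hk : 0 < κ := by linarith
  have : 0 < √(2 * κ * d / n) := Real.sqrt_pos.2 (by positivity)
  unfold muPert; positivity

/-- `92.7522 = 2 · 6.81²`; it exceeds `2 · 46` and `67 / 0.73`, which is what the deviation bound
requires. -/
theorem muPert_sq (hκ : 1 < κ) (hn : 0 < n) :
    n * muPert κ n d ^ 2 = 92.7522 * (κ * d) := by
  have hn' : (0:ℝ) < n := by exact_mod_cast hn
  have hk : 0 < κ := by linarith
  unfold muPert
  rw [mul_pow, Real.sq_sqrt (by positivity)]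
  field_simp
  norm_num
  ring

/-- This is the sample size condition divided by `√n`. The coefficient `20` exceeds `2 · 6.81 · √2`,
while `5 / 2 = 2 + 1 / 2` collects the multiples of `muVar`, and `1 / (2 (κ - 1))` comes from `scale
= muVar / (κ - 1)`. -/
theorem two_mu_add_lt_one (hκ : 1 < κ) (hn : sampleBound κ ε d < n) (hL : 0 < logTerm ε d) :
    2 * mu κ ε n d + (muVar κ ε n d + scale κ ε n d) / 2 < 1 := by
  have hk : 0 < κ - 1 := by linarith
  have hk0 : 0 < κ := by linarith
  have hn' : (0:ℝ) < n := lt_of_le_of_lt (sq_nonneg _) hn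
  have hnn : 0 < n := by exact_mod_cast hn'
  have hs : 0 < √(n : ℝ) := Real.sqrt_pos.2 hn'
  have h1 : 20 * √(κ * d) + (5 / 2 + 1 / (2 * (κ - 1))) * √(2 * (κ - 1) * logTerm ε d) < √n :=
    Real.lt_sqrt_of_sq_lt hn
  have hv : √(2 * (κ - 1) * logTerm ε d) = muVar κ ε n d * √n := by
    unfold muVar
    rw [← Real.sqrt_mul' _ hn'.le]
    congr 1; field_simp
  have hp : √(2 * κ * d / n) * √n = √2 * √(κ * d) := by
    rw [← Real.sqrt_mul' _ hn'.le, ← Real.sqrt_mul zero_le_two]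
    congr 1; field_simp
  have h2 : √2 ≤ 1.4143 := Real.sqrt_le_iff.2 ⟨by norm_num, by norm_num⟩
  have hpp : 2 * muPert κ n d * √n ≤ 20 * √(κ * d) := by
    unfold muPert
    have : 2 * (6.81 * √(2 * κ * d / n)) * √n = 13.62 * (√2 * √(κ * d)) := by rw [← hp]; ring
    rw [this]
    nlinarith [Real.sqrt_nonneg (κ * d)]
  have hsc : (5 / 2 + 1 / (2 * (κ - 1))) * √(2 * (κ - 1) * logTerm ε d) =
      (5 / 2 * muVar κ ε n d + scale κ ε n d / 2) * √n := by
    rw [hv, muVar_eq hκ hnn]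
    field_simp
  rw [hsc] at h1
  have h3 : (2 * muPert κ n d + (5 / 2 * muVar κ ε n d + scale κ ε n d / 2)) * √n < 1 * √n := by
    linarith
  have := lt_of_mul_lt_mul_right h3 hs.le
  rw [mu_eq]
  linarith

theorem mu_pos (hκ : 1 < κ) (hn : 0 < n) (hd : 0 < d) : 0 < mu κ ε n d := by
  rw [mu_eq]
  exact add_pos_of_nonneg_of_pos (Real.sqrt_nonneg _) (muPert_pos hκ hn hd)

theorem mu_nonneg : 0 ≤ mu κ ε n d := by
  unfold mu; positivity

theorem delta_mul (hμ : 4 * mu κ ε n d < 1) :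
    delta κ ε n d * (1 - 2 * mu κ ε n d) = mu κ ε n d := by
  have : (0:ℝ) < 1 - 2 * mu κ ε n d := by linarith [mu_nonneg (κ := κ) (ε := ε) (n := n) (d := d)]
  exact div_mul_cancel₀ _ this.ne'

theorem delta_nonneg (hμ : 4 * mu κ ε n d < 1) : 0 ≤ delta κ ε n d := by
  have h := mu_nonneg (κ := κ) (ε := ε) (n := n) (d := d)
  exact div_nonneg h (by linarith)

theorem delta_lt (hμ : 4 * mu κ ε n d < 1) : delta κ ε n d < 1 / 2 := by
  have h := mu_nonneg (κ := κ) (ε := ε) (n := n) (d := d)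
  unfold delta
  rw [div_lt_iff₀ (by linarith)]
  linarith

/-- The left side is at most `-δ + μ + scale δ² / 2 = -2 μ δ + scale δ² / 2`, because `δ (1 - 2 μ) =
μ`. The sample size condition gives `scale δ ≤ 2 μ`. -/
theorem upper_bracket_nonpos (hκ : 1 < κ) (hn : sampleBound κ ε d < n) (hL : 0 < logTerm ε d)
    (hμ : 4 * mu κ ε n d < 1) :
    1 * (1 - delta κ ε n d - 1) + muVar κ ε n d * ((1 - delta κ ε n d) ^ 2 + 1) / 2 +
      scale κ ε n d * (1 - delta κ ε n d - 1) ^ 2 / 2 +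
      (1 - delta κ ε n d) * muPert κ n d ≤ 0 := by
  have h1 := two_mu_add_lt_one hκ hn hL
  have h2 := delta_mul hμ
  have h3 := delta_nonneg hμ
  have h4 := delta_lt hμ
  have h5 : 0 ≤ muVar κ ε n d := Real.sqrt_nonneg _
  have h6 : 0 ≤ muPert κ n d := by unfold muPert; positivity
  have h7 := mu_eq κ ε n d
  set δ := delta κ ε n d
  have a1 : muVar κ ε n d * ((1 - δ) ^ 2 + 1) / 2 ≤ muVar κ ε n d := by
    have : (1 - δ) ^ 2 ≤ 1 := by nlinarith
    nlinarith [mul_le_mul_of_nonneg_left this h5]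
  have a2 : (1 - δ) * muPert κ n d ≤ muPert κ n d := by nlinarith
  have a3 : scale κ ε n d * δ ≤ 2 * mu κ ε n d := by nlinarith
  have a4 : scale κ ε n d * δ * δ ≤ 2 * mu κ ε n d * δ := mul_le_mul_of_nonneg_right a3 h3
  nlinarith [mul_nonneg (mu_nonneg (κ := κ) (ε := ε) (n := n) (d := d)) h3]

/-- From `δ (1 - 2 μ) = μ`, the left side is `-μ δ + (muVar + scale) δ² / 2`, and the sample size
condition gives `(muVar + scale) / 2 < 1 - 2 μ`. Strictness needs `μ > 0`, hence `d > 0`. -/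
theorem lower_bracket_neg (hκ : 1 < κ) (hn : sampleBound κ ε d < n) (hL : 0 < logTerm ε d)
    (hd : 0 < d) (hμ : 4 * mu κ ε n d < 1) :
    -1 * (1 + delta κ ε n d - 1) + muVar κ ε n d * ((1 + delta κ ε n d) ^ 2 + 1) / 2 +
      scale κ ε n d * (1 + delta κ ε n d - 1) ^ 2 / 2 +
      (1 + delta κ ε n d) * muPert κ n d < 0 := by
  have hn' : (0:ℝ) < n := lt_of_le_of_lt (sq_nonneg _) hn
  have hnn : 0 < n := by exact_mod_cast hn'
  have h0 : 0 < mu κ ε n d := mu_pos hκ hnn hd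
  have h1 := two_mu_add_lt_one hκ hn hL
  have h2 := delta_mul hμ
  have h7 := mu_eq κ ε n d
  have h3 : 0 < delta κ ε n d := div_pos h0 (by linarith)
  set δ := delta κ ε n d
  have a3 : (muVar κ ε n d + scale κ ε n d) / 2 * δ < mu κ ε n d := by nlinarith
  have a4 := mul_lt_mul_of_pos_right a3 h3
  have e : -1 * (1 + δ - 1) + muVar κ ε n d * ((1 + δ) ^ 2 + 1) / 2 +
      scale κ ε n d * (1 + δ - 1) ^ 2 / 2 + (1 + δ) * muPert κ n d =
      -δ + (1 + δ) * (muVar κ ε n d + muPert κ n d) +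
        (muVar κ ε n d + scale κ ε n d) / 2 * δ * δ := by ring
  rw [e, ← h7]
  nlinarith

/-- The precision is `β = lam n muPert`. Then the entropy and the term in `46` cost at most `muPert
a / 2` each, in units of `n lam`, and the term in `67` is at most `0.73 d`, which completes `log
ε⁻¹` into `logTerm = n lam muVar / 2`. The factor `κ` splits as `(κ - 1) + 1`. -/
theorem deviation_le (hκ : 1 < κ) (hn : 0 < n) (hd : 0 < d) (hL : 0 < logTerm ε d)
    {e a : ℝ} (ha : 0 < a) {lam : ℝ} (hlam : lam = scale κ ε n d) :
    n * (e * (lam * (a - 1)) + lam ^ 2 * (κ * a ^ 2 - 2 * a + 1) / 2 +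
      46 * (lam ^ 2 / (lam * n * muPert κ n d) * (κ * a * d)) +
      67 * (lam ^ 2 / (lam * n * muPert κ n d) ^ 2 * (κ * d ^ 2))) +
      (lam * n * muPert κ n d * a / 2 + Real.log ε⁻¹) ≤
    n * lam * (e * (a - 1) + muVar κ ε n d * (a ^ 2 + 1) / 2 + lam * (a - 1) ^ 2 / 2 +
      a * muPert κ n d) := by
  have hn' : (0:ℝ) < n := by exact_mod_cast hn
  have hp := muPert_pos hκ hn hd
  have hl : 0 < lam := hlam ▸ scale_pos hκ hn hL
  have hsq := muPert_sq (d := d) hκ hn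
  have hLe := logTerm_eq hκ hn hL
  have hv : muVar κ ε n d = lam * (κ - 1) := hlam ▸ muVar_eq hκ hn
  rw [← hlam] at hLe
  have hLd : Real.log ε⁻¹ = logTerm ε d - 0.73 * d := by unfold logTerm; ring
  have hκd : κ * d = n * muPert κ n d ^ 2 / 92.7522 := by rw [hsq]; norm_num
  have t1 : lam ^ 2 / (lam * n * muPert κ n d) * (κ * a * d) =
      lam * a * muPert κ n d / 92.7522 := by
    rw [show κ * a * d = a * (κ * d) by ring, hκd]
    field_simp
  have t2 : lam ^ 2 / (lam * n * muPert κ n d) ^ 2 * (κ * d ^ 2) = d / (92.7522 * n) := by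
    rw [show κ * (d:ℝ) ^ 2 = κ * d * d by ring, hκd]
    field_simp
  rw [t1, t2, hLd, hLe, hv]
  have hd' : (0:ℝ) < d := by exact_mod_cast hd
  have t3 : (n : ℝ) * (67 * (d / (92.7522 * n))) = 67 / 92.7522 * d := by field_simp
  have t4 : 0 ≤ (n : ℝ) * lam * a * muPert κ n d := by positivity
  have t5 : (67 / 92.7522 : ℝ) * d ≤ 0.73 * d := by
    gcongr; norm_num
  have t6 : (n : ℝ) * (46 * (lam * a * muPert κ n d / 92.7522)) ≤
      1 / 2 * (n * lam * a * muPert κ n d) := by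
    have : (n : ℝ) * (46 * (lam * a * muPert κ n d / 92.7522)) =
      46 / 92.7522 * (n * lam * a * muPert κ n d) := by ring
    rw [this]
    exact mul_le_mul_of_nonneg_right (by norm_num) t4
  linarith

end parameters

/-! ### Bracketing the robust energy -/

section estimator

variable {d n : ℕ} {lam : ℝ} {x : Fin n → Vec d} {θ : Vec d}

theorem Nhat_nonneg (lam : ℝ) (x : Fin n → Vec d) (θ : Vec d) : 0 ≤ Nhat lam x θ :=
  Real.sInf_nonneg fun _ ht => ht.1.le

theorem Nhat_eq_zero (hlam : 0 ≤ lam) (h : ∀ i, inner ℝ θ (x i) = 0) : Nhat lam x θ = 0 := by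
  have : {t : ℝ | 0 < t ∧ ∑ i, psi (lam * (t⁻¹ * (inner ℝ θ (x i)) ^ 2 - 1)) ≤ 0} = Set.Ioi 0 := by
    ext t
    simp only [h, Set.mem_ofPred_eq, Set.mem_Ioi, and_iff_left_iff_imp]
    intro _
    refine Finset.sum_nonpos fun i _ => ?_
    have h0 : psi 0 = 0 := by norm_num [psi, psiPos]
    exact (monotone_psi (by simpa using hlam)).trans_eq h0
  unfold Nhat
  rw [this, csInf_Ioi]

theorem Nhat_le {t : ℝ} (ht : 0 < t)
    (h : ∑ i, psi (lam * (t⁻¹ * (inner ℝ θ (x i)) ^ 2 - 1)) ≤ 0) : Nhat lam x θ ≤ t :=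
  csInf_le ⟨0, fun _ hs => hs.1.le⟩ ⟨ht, h⟩

/-- The estimating sum is nonincreasing in its threshold, so every admissible threshold exceeds `s`.
The value `t` only makes the set nonempty, as the infimum of the empty set is `0` by convention. -/
theorem le_Nhat (hlam : 0 ≤ lam) {s t : ℝ} (ht : 0 < t)
    (h : ∑ i, psi (lam * (t⁻¹ * (inner ℝ θ (x i)) ^ 2 - 1)) ≤ 0)
    (hs' : 0 < ∑ i, psi (lam * (s⁻¹ * (inner ℝ θ (x i)) ^ 2 - 1))) : s ≤ Nhat lam x θ := by
  refine le_csInf ⟨t, ht, h⟩ fun r hr => ?_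
  by_contra! hlt
  refine absurd hr.2 (not_le.2 (hs'.trans_le (Finset.sum_le_sum fun i _ => monotone_psi ?_)))
  have : s⁻¹ ≤ r⁻¹ := inv_anti₀ hr.1 hlt.le
  gcongr

end estimator

/-- The uniform bound for the robust energy estimator, with the inclusion of the sample in the
range of the Gram matrix. -/
theorem exists_event_Nhat {d n : ℕ} {κ ε : ℝ} (hκ : 1 < κ) (hε : 0 < ε) (hε2 : ε < 1 / 2)
    (hn : sampleBound κ ε d < n) (hμ : 4 * mu κ ε n d < 1)
    {P : Measure (Vec d)} [IsProbabilityMeasure P] (hP : MemLp (fun x : Vec d => x) 2 P)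
    (hkurt : kurtosis P ≤ ENNReal.ofReal κ)
    {Ω : Type*} [MeasurableSpace Ω] {Pr : Measure Ω} [IsProbabilityMeasure Pr]
    {X : Fin n → Ω → Vec d} (hX : ∀ i, Measurable (X i)) (hmap : ∀ i, Pr.map (X i) = P)
    (hind : iIndepFun X Pr) :
    ∃ B : Set Ω, MeasurableSet B ∧ ENNReal.ofReal (1 - 2 * ε) ≤ Pr B ∧ ∀ ω ∈ B,
      (∀ i, X i ω ∈ gramRange P) ∧ ∀ θ : Vec d,
        (1 - delta κ ε n d) * Nhat (scale κ ε n d) (fun i => X i ω) θ ≤ energy P θ ∧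
        energy P θ ≤ (1 + delta κ ε n d) * Nhat (scale κ ε n d) (fun i => X i ω) θ := by
  have hL : 0 < logTerm ε d := logTerm_pos hε (by linarith) d
  have hn' : (0:ℝ) < n := lt_of_le_of_lt (sq_nonneg _) hn
  have hnn : 0 < n := by exact_mod_cast hn'
  have hκ0 : 0 ≤ κ := by linarith
  have hlam : 0 < scale κ ε n d := scale_pos hκ hnn hL
  set lam := scale κ ε n d with hlamdef
  have hδ0 := delta_nonneg hμ
  have hδ1 := delta_lt hμ
  have hub := upper_bracket_nonpos hκ hn hL hμ
  have hlb := fun hd => lower_bracket_neg hκ hn hL hd hμ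
  set δ := delta κ ε n d
  have hzero : ∀ x : Fin n → Vec d, (∀ i, x i ∈ gramRange P) → ∀ θ, energy P θ = 0 →
      (1 - δ) * Nhat lam x θ ≤ energy P θ ∧ energy P θ ≤ (1 + δ) * Nhat lam x θ := by
    intro x hx θ hθ
    rw [hθ, Nhat_eq_zero hlam.le fun i => inner_eq_zero_of_mem_gramRange hP (hx i) hθ]
    simp
  rcases Nat.eq_zero_or_pos d with hd | hd
  -- In dimension `0` the precision `β` would vanish, but all energies are `0`.
  · subst hd
    have hR : ∀ x : Vec 0, x ∈ gramRange P := fun x j => j.elim0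
    refine ⟨Set.univ, MeasurableSet.univ, ?_, fun ω _ => ⟨fun i => hR _, fun θ => ?_⟩⟩
    · rw [measure_univ, ENNReal.ofReal_le_one]; linarith
    · refine hzero _ (fun i => hR _) θ ?_
      rw [Subsingleton.elim θ 0]
      simp [energy]
  · have hp := muPert_pos hκ hnn hd
    have hβ : 0 < lam * n * muPert κ n d := by positivity
    obtain ⟨B₁, hB₁m, hB₁, hB₁ω⟩ := exists_event_sum_psi_energy_le hP hκ0 hkurt hX hmap hind
      (e := 1) (by norm_num) hlam hβ hε
    obtain ⟨B₂, hB₂m, hB₂, hB₂ω⟩ := exists_event_sum_psi_energy_le hP hκ0 hkurt hX hmap hind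
      (e := -1) (by norm_num) hlam hβ hε
    set B₃ : Set Ω := ⋂ i, X i ⁻¹' gramRange P with hB₃def
    have hB₃m : MeasurableSet B₃ := MeasurableSet.iInter fun i => hX i measurableSet_gramRange
    have hB₃ : Pr B₃ᶜ = 0 := by
      have : ∀ᵐ ω ∂Pr, ω ∈ B₃ := by
        simp only [hB₃def, Set.mem_iInter, Set.mem_preimage]
        rw [ae_all_iff]
        intro i
        have : ∀ᵐ x ∂(Pr.map (X i)), x ∈ gramRange P := by
          rw [hmap i]; exact ae_mem_gramRange hP
        exact ae_of_ae_map (hX i).aemeasurable this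
      exact this
    refine ⟨B₁ ∩ B₂ ∩ B₃, (hB₁m.inter hB₂m).inter hB₃m, ?_, ?_⟩
    · have hc : Pr (B₁ ∩ B₂ ∩ B₃)ᶜ ≤ ENNReal.ofReal (2 * ε) := by
        rw [Set.compl_inter, Set.compl_inter]
        calc _ ≤ Pr B₁ᶜ + Pr B₂ᶜ + Pr B₃ᶜ :=
              (measure_union_le _ _).trans (add_le_add (measure_union_le _ _) le_rfl)
          _ ≤ ENNReal.ofReal ε + ENNReal.ofReal ε + 0 := by
              rw [hB₃]; gcongr
          _ = _ := by rw [add_zero, ← ENNReal.ofReal_add hε.le hε.le]; ring_nf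
      have hm := prob_compl_eq_one_sub (μ := Pr) ((hB₁m.inter hB₂m).inter hB₃m).compl
      rw [compl_compl] at hm
      rw [hm, ENNReal.ofReal_sub _ (by positivity), ENNReal.ofReal_one]
      exact tsub_le_tsub_left hc 1
    · rintro ω ⟨⟨h1, h2⟩, h3⟩
      have hR : ∀ i, X i ω ∈ gramRange P := by simpa [hB₃def] using h3
      refine ⟨hR, fun θ => ?_⟩
      rcases (energy_nonneg P θ).eq_or_lt with h0 | h0
      · exact hzero _ hR θ h0.symm
      set N := energy P θ
      -- Testing the threshold `N / a` in direction `θ` amounts to the threshold `1` in a rescaled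
      -- direction of energy `a`. It is used with `a = 1 - δ` and `a = 1 + δ`.
      have key : ∀ a : ℝ, 0 < a → energy P (√(a / N) • θ) = a ∧
          ∀ i, inner ℝ (√(a / N) • θ) (X i ω) ^ 2 = (N / a)⁻¹ * inner ℝ θ (X i ω) ^ 2 := by
        intro a ha
        have hq : √(a / N) ^ 2 = a / N := Real.sq_sqrt (by positivity)
        refine ⟨?_, fun i => ?_⟩
        · rw [energy_smul, hq]; exact div_mul_cancel₀ a h0.ne'
        · rw [real_inner_smul_left, mul_pow, hq, inv_div]
      have hup : ∑ i, psi (lam * ((N / (1 - δ))⁻¹ * inner ℝ θ (X i ω) ^ 2 - 1)) ≤ 0 := by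
        obtain ⟨k1, k2⟩ := key (1 - δ) (by linarith)
        have h := hB₁ω ω h1 hR (√((1 - δ) / N) • θ) (by rw [k1]; linarith)
        rw [k1] at h
        simp_rw [k2, one_mul (lam * _)] at h
        have h' := h.trans (by
          have := deviation_le (e := 1) (a := 1 - δ) hκ hnn hd hL (by linarith) hlamdef
          simpa only [one_mul] using this)
        refine h'.trans (mul_nonpos_of_nonneg_of_nonpos (by positivity) ?_)
        simpa only [one_mul] using hub
      have hlow : 0 < ∑ i, psi (lam * ((N / (1 + δ))⁻¹ * inner ℝ θ (X i ω) ^ 2 - 1)) := by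
        obtain ⟨k1, k2⟩ := key (1 + δ) (by linarith)
        have h := hB₂ω ω h2 hR (√((1 + δ) / N) • θ) (by rw [k1]; linarith)
        rw [k1] at h
        have h' := h.trans (deviation_le hκ hnn hd hL (by linarith) hlamdef)
        have h'' := h'.trans_lt (mul_neg_of_pos_of_neg (by positivity) (hlb hd))
        simp_rw [k2, neg_one_mul (lam * _), psi_neg, Finset.sum_neg_distrib] at h''
        linarith
      have hpos1 : 0 < N / (1 - δ) := div_pos h0 (by linarith)
      constructor
      · have := Nhat_le hpos1 hup
        rw [le_div_iff₀ (by linarith)] at this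
        linarith
      · have := le_Nhat hlam.le hpos1 hup hlow
        rw [div_le_iff₀ (by linarith)] at this
        linarith

/-! ### Comparison of ordered eigenvalues -/

section eigenvalues

/-- There are `m - 1` linear conditions in dimension `m`. Index `i` is filled with the zero vector,
so the square system is not surjective and hence not injective. -/
theorem exists_ne_zero_inner_eq_zero {d m : ℕ} (hm : Module.finrank ℝ (Vec d) = m)
    (b c : Fin m → Vec d) (i : Fin m) :
    ∃ θ : Vec d, θ ≠ 0 ∧ (∀ j, i < j → inner ℝ (b j) θ = 0) ∧ ∀ j, j < i → inner ℝ (c j) θ = 0 := by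
  set u : Fin m → Vec d := fun j => if i < j then b j else if j < i then c j else 0 with hu
  let f : Vec d →ₗ[ℝ] (Fin m → ℝ) := LinearMap.pi fun j => (innerSL ℝ (u j)).toLinearMap
  have hf : ∀ θ j, f θ j = inner ℝ (u j) θ := fun θ j => rfl
  have hns : ¬ Function.Surjective f := by
    intro hs
    obtain ⟨θ, hθ⟩ := hs (Pi.single i 1)
    have := congrFun hθ i
    rw [hf, hu] at this
    simp at this
  have hni : ¬ Function.Injective f := by
    rwa [LinearMap.injective_iff_surjective_of_finrank_eq_finrank (by simpa using hm)]
  rw [injective_iff_map_eq_zero] at hni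
  push Not at hni
  obtain ⟨θ, h0, hne⟩ := hni
  refine ⟨θ, hne, fun j hj => ?_, fun j hj => ?_⟩
  · have := congrFun h0 j
    rw [hf, hu] at this
    simpa [hj] using this
  · have := congrFun h0 j
    rw [hf, hu] at this
    simpa [hj, not_lt.2 hj.le] using this

/-- Monotonicity of the ordered coefficients of a quadratic form, a consequence of the
Courant–Fischer principle. -/
theorem le_of_sum_mul_inner_sq_le {d m : ℕ} (b c : OrthonormalBasis (Fin m) ℝ (Vec d))
    {s t : Fin m → ℝ} (hs : Antitone s) (ht : Antitone t)
    (h : ∀ θ, ∑ j, s j * inner ℝ (b j) θ ^ 2 ≤ ∑ j, t j * inner ℝ (c j) θ ^ 2) (i : Fin m) :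
    s i ≤ t i := by
  have hm : Module.finrank ℝ (Vec d) = m := by
    rw [Module.finrank_eq_card_basis b.toBasis, Fintype.card_fin]
  obtain ⟨θ, hne, hb, hc⟩ := exists_ne_zero_inner_eq_zero hm b c i
  have h1 : s i * ‖θ‖ ^ 2 ≤ ∑ j, s j * inner ℝ (b j) θ ^ 2 := by
    rw [← b.sum_sq_inner_right θ, Finset.mul_sum]
    refine Finset.sum_le_sum fun j _ => ?_
    rcases le_or_gt j i with hj | hj
    · exact mul_le_mul_of_nonneg_right (hs hj) (sq_nonneg _)
    · rw [hb j hj]; simp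
  have h2 : ∑ j, t j * inner ℝ (c j) θ ^ 2 ≤ t i * ‖θ‖ ^ 2 := by
    rw [← c.sum_sq_inner_right θ, Finset.mul_sum]
    refine Finset.sum_le_sum fun j _ => ?_
    rcases le_or_gt i j with hj | hj
    · exact mul_le_mul_of_nonneg_right (ht hj) (sq_nonneg _)
    · rw [hc j hj]; simp
  have hpos : 0 < ‖θ‖ ^ 2 := by positivity
  exact le_of_mul_le_mul_right (h1.trans ((h θ).trans h2)) hpos

variable {d : ℕ}

/-- An orthonormal basis of eigenvectors, indexed as the sorted eigenvalues. -/
noncomputable def sortedBasis {H : Matrix (Fin d) (Fin d) ℝ} (hH : H.IsHermitian) :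
    OrthonormalBasis (Fin (Fintype.card (Fin d))) ℝ (Vec d) :=
  hH.eigenvectorBasis.reindex (Fintype.equivOfCardEq (Fintype.card_fin _)).symm

theorem quadForm_eq_sum_sorted {H : Matrix (Fin d) (Fin d) ℝ} (hH : H.IsHermitian) (θ : Vec d) :
    quadForm H θ = ∑ j, hH.eigenvalues₀ j * inner ℝ (sortedBasis hH j) θ ^ 2 := by
  rw [quadForm_eq_sum_eigenvalues hH,
    ← (Fintype.equivOfCardEq (Fintype.card_fin (Fintype.card (Fin d)))).sum_comp]
  refine Finset.sum_congr rfl fun j _ => ?_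
  simp [sortedBasis, Matrix.IsHermitian.eigenvalues]

theorem quadForm_sortedBasis {H : Matrix (Fin d) (Fin d) ℝ} (hH : H.IsHermitian)
    (j : Fin (Fintype.card (Fin d))) : quadForm H (sortedBasis hH j) = hH.eigenvalues₀ j := by
  have := quadForm_eigenvectorBasis hH (Fintype.equivOfCardEq (Fintype.card_fin _) j)
  simpa [sortedBasis, Matrix.IsHermitian.eigenvalues] using this

theorem ratioErrLE_of_abs_sub_le {a b c : ℝ} (hb : 0 ≤ b) (hc : 0 ≤ c) (h : |a - b| ≤ c * b) :
    RatioErrLE a b c := by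
  unfold RatioErrLE
  split_ifs with h0
  · subst h0
    rw [mul_zero, sub_zero] at h
    exact ⟨abs_nonpos_iff.1 h, hc⟩
  · have hb' : 0 < b := lt_of_le_of_ne hb (Ne.symm h0)
    rw [div_sub_one h0, abs_div, abs_of_pos hb', div_le_iff₀ hb']
    exact h

/-- A relative bound between nonnegative quadratic forms passes to the sorted eigenvalues. -/
theorem abs_eigenvalues_sub_le {G H : Matrix (Fin d) (Fin d) ℝ} (hG : G.IsHermitian)
    (hH : H.IsHermitian) {c : ℝ} (hc : 0 ≤ c) (hG0 : ∀ θ, 0 ≤ quadForm G θ)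
    (hH0 : ∀ θ, 0 ≤ quadForm H θ) (h : ∀ θ, |quadForm H θ - quadForm G θ| ≤ c * quadForm G θ)
    (i : Fin (Fintype.card (Fin d))) :
    |hH.eigenvalues₀ i - hG.eigenvalues₀ i| ≤ c * hG.eigenvalues₀ i := by
  have hgi : 0 ≤ hG.eigenvalues₀ i := by rw [← quadForm_sortedBasis]; exact hG0 _
  have hhi : 0 ≤ hH.eigenvalues₀ i := by rw [← quadForm_sortedBasis]; exact hH0 _
  have hscale : ∀ (a : ℝ) θ, ∑ j, a * hG.eigenvalues₀ j * inner ℝ (sortedBasis hG j) θ ^ 2 =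
      a * quadForm G θ := fun a θ => by
    rw [quadForm_eq_sum_sorted hG, Finset.mul_sum]
    exact Finset.sum_congr rfl fun j _ => by ring
  have hanti : ∀ a : ℝ, 0 ≤ a → Antitone fun j => a * hG.eigenvalues₀ j := fun a ha j k hjk =>
    mul_le_mul_of_nonneg_left (hG.eigenvalues₀_antitone hjk) ha
  have hup : hH.eigenvalues₀ i ≤ (1 + c) * hG.eigenvalues₀ i := by
    refine le_of_sum_mul_inner_sq_le (sortedBasis hH) (sortedBasis hG) hH.eigenvalues₀_antitone
      (hanti (1 + c) (by linarith)) (fun θ => ?_) i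
    rw [hscale, ← quadForm_eq_sum_sorted]
    linarith [(abs_le.1 (h θ)).2]
  have hlow : (1 - c) * hG.eigenvalues₀ i ≤ hH.eigenvalues₀ i := by
    rcases le_or_gt c 1 with hc1 | hc1
    · refine le_of_sum_mul_inner_sq_le (sortedBasis hG) (sortedBasis hH)
        (hanti (1 - c) (by linarith)) hH.eigenvalues₀_antitone (fun θ => ?_) i
      rw [hscale, ← quadForm_eq_sum_sorted]
      linarith [(abs_le.1 (h θ)).1]
    -- For `c > 1` the coefficients `(1 - c) * hG.eigenvalues₀` need not be antitone, but the lower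
    -- bound is nonpositive.
    · exact (mul_nonpos_of_nonpos_of_nonneg (by linarith) hgi).trans hhi
  exact abs_le.2 ⟨by linarith, by linarith⟩

end eigenvalues

/-! ### Frobenius norm and Lipschitz bounds -/

section frobenius

variable {d : ℕ}

theorem trace_mul_self_eq {H : Matrix (Fin d) (Fin d) ℝ} (hH : H.IsSymm) :
    (H * H).trace = ∑ i, ∑ j, H i j ^ 2 := by
  simp only [Matrix.trace, Matrix.diag, Matrix.mul_apply]
  refine Finset.sum_congr rfl fun i _ => Finset.sum_congr rfl fun j _ => ?_
  rw [hH.apply i j]; ring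

theorem norm_mulVec_le {H : Matrix (Fin d) (Fin d) ℝ} (hH : H.IsSymm) (v : Vec d) :
    ‖(WithLp.toLp 2 (H.mulVec v.ofLp) : Vec d)‖ ≤ √(H * H).trace * ‖v‖ := by
  rw [← Real.sqrt_sq (norm_nonneg v), ← Real.sqrt_mul' _ (sq_nonneg _)]
  refine Real.le_sqrt_of_sq_le ?_
  rw [EuclideanSpace.real_norm_sq_eq, EuclideanSpace.real_norm_sq_eq, trace_mul_self_eq hH,
    Finset.sum_mul]
  refine Finset.sum_le_sum fun i _ => ?_
  exact Finset.sum_mul_sq_le_sq_mul_sq Finset.univ (fun j => H i j) fun j => v j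

/-- By symmetry the difference is `⟨θ - ξ, H (θ + ξ)⟩`, and the Frobenius norm dominates the
operator norm. -/
theorem abs_quadForm_sub_le {H : Matrix (Fin d) (Fin d) ℝ} (hH : H.IsSymm) {θ ξ : Vec d}
    (hθ : ‖θ‖ = 1) (hξ : ‖ξ‖ = 1) :
    |quadForm H θ - quadForm H ξ| ≤ 2 * √(H * H).trace * ‖θ - ξ‖ := by
  have hsum : (WithLp.toLp 2 (H.mulVec (θ + ξ).ofLp) : Vec d) =
      WithLp.toLp 2 (H.mulVec θ.ofLp) + WithLp.toLp 2 (H.mulVec ξ.ofLp) := by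
    rw [WithLp.ofLp_add, Matrix.mulVec_add, WithLp.toLp_add]
  have e : quadForm H θ - quadForm H ξ =
      inner ℝ (θ - ξ) (WithLp.toLp 2 (H.mulVec (θ + ξ).ofLp)) := by
    rw [hsum, inner_sub_left, inner_add_right, inner_add_right, quadForm_eq_inner,
      quadForm_eq_inner, inner_mulVec_comm hH θ ξ, real_inner_comm ξ]
    ring
  rw [e]
  have h1 := norm_mulVec_le hH (θ + ξ)
  have h2 : ‖θ + ξ‖ ≤ 2 := (norm_add_le _ _).trans (by rw [hθ, hξ]; norm_num)
  calc _ ≤ ‖θ - ξ‖ * ‖(WithLp.toLp 2 (H.mulVec (θ + ξ).ofLp) : Vec d)‖ :=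
        abs_real_inner_le_norm _ _
    _ ≤ ‖θ - ξ‖ * (√(H * H).trace * 2) := by
        gcongr
        exact h1.trans (by gcongr)
    _ = _ := by ring

theorem quadForm_smul (H : Matrix (Fin d) (Fin d) ℝ) (c : ℝ) (θ : Vec d) :
    quadForm H (c • θ) = c ^ 2 * quadForm H θ := by
  simp only [quadForm, WithLp.ofLp_smul, Matrix.mulVec_smul, smul_dotProduct, dotProduct_smul,
    smul_eq_mul]
  ring

/-- The trace of a nonnegative matrix in an orthonormal basis bounds its Frobenius norm. -/
theorem sqrt_trace_mul_self_le {G : Matrix (Fin d) (Fin d) ℝ} (hG : G.IsHermitian)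
    (hG0 : ∀ θ, 0 ≤ quadForm G θ) (e : OrthonormalBasis (Fin d) ℝ (Vec d)) :
    √(G * G).trace ≤ ∑ i, quadForm G (e i) := by
  have hs : G.IsSymm := by simpa [Matrix.IsHermitian, Matrix.IsSymm] using hG
  set b := hG.eigenvectorBasis with hb
  have hl : ∀ j, 0 ≤ hG.eigenvalues j := fun j => by
    rw [← quadForm_eigenvectorBasis]; exact hG0 _
  -- Parseval's identity in the basis `e`. It yields both the trace of `G` in an arbitrary basis
  -- and, with `f` the squared eigenvalues, the trace of `G * G`; the conclusion is then `∑ λ² ≤ (∑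
  -- λ)²` for nonnegative eigenvalues.
  have hsum : ∀ (f : Fin d → ℝ) (e : OrthonormalBasis (Fin d) ℝ (Vec d)),
      ∑ i, ∑ j, f j * inner ℝ (b j) (e i) ^ 2 = ∑ j, f j := by
    intro f e
    rw [Finset.sum_comm]
    refine Finset.sum_congr rfl fun j _ => ?_
    rw [← Finset.mul_sum]
    simp_rw [real_inner_comm (e _) (b j)]
    rw [e.sum_sq_inner_right, b.norm_eq_one]; simp
  have htr : ∑ i, quadForm G (e i) = ∑ j, hG.eigenvalues j := by
    simp_rw [quadForm_eq_sum_eigenvalues hG]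
    exact hsum _ e
  have hfr : (G * G).trace = ∑ j, hG.eigenvalues j ^ 2 := by
    rw [trace_mul_self_eq hs, Finset.sum_comm,
      ← hsum (fun j => hG.eigenvalues j ^ 2) (EuclideanSpace.basisFun (Fin d) ℝ)]
    refine Finset.sum_congr rfl fun i _ => ?_
    have h1 : ∑ k, G k i ^ 2 = ‖(WithLp.toLp 2
        (G.mulVec (EuclideanSpace.basisFun (Fin d) ℝ i).ofLp) : Vec d)‖ ^ 2 := by
      rw [EuclideanSpace.real_norm_sq_eq]
      simp
    rw [h1, ← b.sum_sq_inner_right]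
    refine Finset.sum_congr rfl fun j _ => ?_
    rw [inner_mulVec_comm hs, mulVec_eigenvectorBasis_toLp, real_inner_smul_left, mul_pow]
  rw [htr, hfr]
  refine Real.sqrt_le_iff.2 ⟨Finset.sum_nonneg fun j _ => hl j, ?_⟩
  exact Finset.sum_sq_le_sq_sum_of_nonneg fun j _ => hl j

end frobenius

/-! ### Existence of a minimizer -/

section minimizer

variable {d n : ℕ} {δ : ℝ} {N : Vec d → ℝ} {x : Fin n → Vec d} {Θ : Finset (Vec d)}

theorem isClosed_feasible : IsClosed (feasible δ N x Θ) := by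
  have hq : ∀ θ : Vec d, Continuous fun H : Matrix (Fin d) (Fin d) ℝ => quadForm H θ := by
    intro θ; unfold quadForm; fun_prop
  have h1 : IsClosed {H : Matrix (Fin d) (Fin d) ℝ | H.IsSymm} :=
    isClosed_eq (by fun_prop) continuous_id
  have h2 : IsClosed {H : Matrix (Fin d) (Fin d) ℝ | ∀ v : Vec d,
      WithLp.toLp 2 (H.mulVec v.ofLp) ∈ Submodule.span ℝ (Set.range x)} := by
    have : {H : Matrix (Fin d) (Fin d) ℝ | ∀ v : Vec d,
      WithLp.toLp 2 (H.mulVec v.ofLp) ∈ Submodule.span ℝ (Set.range x)} = ⋂ v : Vec d,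
      (fun H : Matrix (Fin d) (Fin d) ℝ => (WithLp.toLp 2 (H.mulVec v.ofLp) : Vec d)) ⁻¹'
        (Submodule.span ℝ (Set.range x) : Set (Vec d)) := by
      ext H; simp
    rw [this]
    refine isClosed_iInter fun v => ?_
    refine (Submodule.closed_of_finiteDimensional _).preimage ?_
    exact (PiLp.continuous_toLp 2 _).comp (by fun_prop)
  have h3 : IsClosed {H : Matrix (Fin d) (Fin d) ℝ |
      ∀ θ ∈ Θ, N θ * (1 - δ) ≤ quadForm H θ ∧ quadForm H θ ≤ N θ * (1 + δ)} := by
    have : {H : Matrix (Fin d) (Fin d) ℝ |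
        ∀ θ ∈ Θ, N θ * (1 - δ) ≤ quadForm H θ ∧ quadForm H θ ≤ N θ * (1 + δ)} =
        ⋂ θ ∈ Θ, {H | N θ * (1 - δ) ≤ quadForm H θ} ∩ {H | quadForm H θ ≤ N θ * (1 + δ)} := by
      ext H; simp
    rw [this]
    exact isClosed_biInter fun θ _ =>
      (isClosed_le continuous_const (hq θ)).inter (isClosed_le (hq θ) continuous_const)
  exact h1.inter (h2.inter h3)

/-- The matrices of the closed constraint set whose Frobenius norm does not exceed that of `G` form
a compact set, and competitors outside it cannot do better. -/
theorem exists_isGramSolution {G : Matrix (Fin d) (Fin d) ℝ} (hG : G ∈ feasible δ N x Θ) :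
    ∃ H, IsGramSolution δ N x Θ H := by
  set r := (G * G).trace
  set S : Set (Matrix (Fin d) (Fin d) ℝ) := feasible δ N x Θ ∩ {H | (H * H).trace ≤ r}
  have htr : Continuous fun H : Matrix (Fin d) (Fin d) ℝ => (H * H).trace := by fun_prop
  have hSc : IsClosed S := isClosed_feasible.inter (isClosed_le htr continuous_const)
  have hcomp : IsCompact (Set.univ.pi fun _ : Fin d => Set.univ.pi fun _ : Fin d =>
      Set.Icc (-√r) (√r)) :=
    isCompact_univ_pi fun _ => isCompact_univ_pi fun _ => isCompact_Icc
  have hsub : S ⊆ (Set.univ.pi fun _ : Fin d => Set.univ.pi fun _ : Fin d =>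
      Set.Icc (-√r) (√r)) := by
    rintro H ⟨hH, hr⟩ i _ j _
    rw [Set.mem_Icc, ← abs_le]
    refine Real.abs_le_sqrt (le_trans ?_ hr)
    rw [trace_mul_self_eq hH.1]
    exact (Finset.single_le_sum (f := fun j => H i j ^ 2) (fun _ _ => sq_nonneg _)
      (Finset.mem_univ j)).trans (Finset.single_le_sum (f := fun i => ∑ j, H i j ^ 2)
        (fun _ _ => Finset.sum_nonneg fun _ _ => sq_nonneg _) (Finset.mem_univ i))
  have hS : IsCompact S := hcomp.of_isClosed_subset hSc hsub
  obtain ⟨H, hHS, hmin⟩ := hS.exists_isMinOn ⟨G, hG, le_refl r⟩ htr.continuousOn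
  refine ⟨H, hHS.1, fun K hK => ?_⟩
  rcases le_total (K * K).trace r with hKr | hKr
  · exact hmin ⟨hK, hKr⟩
  · exact hHS.2.trans hKr

end minimizer

/-! ### The span of the sample -/

section span

variable {d n : ℕ} {x : Fin n → Vec d}

theorem mem_span_orthogonal_iff {θ : Vec d} :
    θ ∈ (Submodule.span ℝ (Set.range x))ᗮ ↔ ∀ i, inner ℝ θ (x i) = 0 := by
  constructor
  · intro h i
    rw [real_inner_comm]
    exact h _ (Submodule.subset_span (Set.mem_range_self i))
  · intro h u hu
    refine Submodule.span_induction (p := fun u _ => inner ℝ u θ = 0) ?_ ?_ ?_ ?_ hu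
    · rintro _ ⟨i, rfl⟩
      rw [real_inner_comm]; exact h i
    · simp
    · intro u v _ _ hu hv; rw [inner_add_left, hu, hv, add_zero]
    · intro a u _ hu; rw [real_inner_smul_left, hu, mul_zero]

/-- A symmetric matrix whose image is in a subspace has a quadratic form that depends on the
projection on this subspace only. -/
theorem quadForm_add_of_mem_orthogonal {H : Matrix (Fin d) (Fin d) ℝ} (hH : H.IsSymm)
    {V : Submodule ℝ (Vec d)} (hV : ∀ v : Vec d, WithLp.toLp 2 (H.mulVec v.ofLp) ∈ V)
    {v w : Vec d} (hw : w ∈ Vᗮ) : quadForm H (v + w) = quadForm H v := by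
  have hz : (WithLp.toLp 2 (H.mulVec w.ofLp) : Vec d) = 0 := by
    rw [← inner_self_eq_zero (𝕜 := ℝ), inner_mulVec_comm hH]
    exact hw _ (hV _)
  have hsum : (WithLp.toLp 2 (H.mulVec (v + w).ofLp) : Vec d) =
      WithLp.toLp 2 (H.mulVec v.ofLp) + WithLp.toLp 2 (H.mulVec w.ofLp) := by
    rw [WithLp.ofLp_add, Matrix.mulVec_add, WithLp.toLp_add]
  rw [quadForm_eq_inner, hsum, hz, add_zero, inner_add_left, real_inner_comm _ w, hw _ (hV _),
    add_zero, quadForm_eq_inner]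

/-- A nonnegative form vanishes at `θ` only if `θ` has no component along eigenvectors with nonzero
eigenvalue. Thus every `θ` in `Vᗮ` is orthogonal to the image of `G`, which is therefore in `Vᗮᗮ =
V`. -/
theorem mem_span_of_quadForm {G : Matrix (Fin d) (Fin d) ℝ} (hG : G.IsHermitian)
    (hG0 : ∀ θ, 0 ≤ quadForm G θ) {V : Submodule ℝ (Vec d)} (hV : ∀ θ ∈ Vᗮ, quadForm G θ = 0)
    (v : Vec d) : WithLp.toLp 2 (G.mulVec v.ofLp) ∈ V := by
  have hs : G.IsSymm := by simpa [Matrix.IsHermitian, Matrix.IsSymm] using hG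
  rw [← Submodule.orthogonal_orthogonal V]
  intro θ hθ
  have h := hV θ hθ
  have hl : ∀ j, 0 ≤ hG.eigenvalues j := fun j => by
    rw [← quadForm_eigenvectorBasis]; exact hG0 _
  rw [quadForm_eq_sum_eigenvalues hG, Finset.sum_eq_zero_iff_of_nonneg
    fun j _ => mul_nonneg (hl j) (sq_nonneg _)] at h
  rw [← hG.eigenvectorBasis.sum_inner_mul_inner]
  refine Finset.sum_eq_zero fun j _ => ?_
  rw [inner_mulVec_comm hs, mulVec_eigenvectorBasis_toLp, real_inner_smul_left,
    real_inner_comm _ θ]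
  rcases mul_eq_zero.1 (h j (Finset.mem_univ j)) with h0 | h0
  · rw [h0]; ring
  · rw [pow_eq_zero_iff two_ne_zero |>.1 h0]; ring

theorem isCompact_spanSphere (x : Fin n → Vec d) : IsCompact (spanSphere x) := by
  have : spanSphere x = (Submodule.span ℝ (Set.range x) : Set (Vec d)) ∩ Metric.sphere 0 1 := by
    ext θ; simp [spanSphere]
  rw [this]
  exact (isCompact_sphere 0 1).inter_left (Submodule.closed_of_finiteDimensional _)

end span

/-! ### From the net to the whole space -/

/-- The elementary inequality behind the passage from the net to the whole sphere. -/
theorem abs_sub_le_of_net {δ g h gξ hξ Nξ Nθ m η : ℝ} (hδ0 : 0 ≤ δ) (hδ : δ < 1 / 2)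
    (hm : 0 ≤ m) (hη : η ≤ (1 + δ) * δ ^ 2 * m) (h1 : |h - hξ| ≤ η) (h2 : |g - gξ| ≤ η)
    (h3 : Nξ * (1 - δ) ≤ hξ) (h3' : hξ ≤ Nξ * (1 + δ)) (h4 : (1 - δ) * Nξ ≤ gξ)
    (h4' : gξ ≤ (1 + δ) * Nξ) (h5 : m ≤ Nξ) (h6 : m ≤ Nθ) (h7 : (1 - δ) * Nθ ≤ g) :
    |h - g| ≤ 2 * δ / (1 - 2 * δ) * g ∧ 0 ≤ h := by
  rw [abs_le] at h1 h2
  have hd1 : 0 < 1 - δ := by linarith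
  have hd2 : 0 < 1 - 2 * δ := by linarith
  have hg : 0 ≤ g := le_trans (mul_nonneg hd1.le (hm.trans h6)) h7
  constructor
  · have hmg : (1 - δ) * m ≤ g := (mul_le_mul_of_nonneg_left h6 hd1.le).trans h7
    have hηg : (1 - δ) * η ≤ (1 + δ) * δ ^ 2 * g := by
      calc (1 - δ) * η ≤ (1 - δ) * ((1 + δ) * δ ^ 2 * m) := by gcongr
        _ = (1 + δ) * δ ^ 2 * ((1 - δ) * m) := by ring
        _ ≤ _ := by gcongr
    have hN : (1 - δ) * Nξ ≤ g + η := by linarith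
    -- At the net point the two forms lie in the same interval of length `2 δ Nξ`, and moving each
    -- of them to `θ` costs `η`.
    have hfin : |h - g| ≤ 2 * η + 2 * δ * Nξ := abs_le.2 ⟨by linarith, by linarith⟩
    refine hfin.trans ?_
    have hkey : (1 - δ) ^ 2 * (2 * η + 2 * δ * Nξ) ≤ 2 * δ * (1 + δ ^ 2) * g := by
      have a1 : (1 - δ) * (2 * δ) * ((1 - δ) * Nξ) ≤ (1 - δ) * (2 * δ) * (g + η) := by gcongr
      nlinarith
    rw [div_mul_eq_mul_div, le_div_iff₀ hd2]
    have hnn : 0 < (1 - δ) ^ 2 := by positivity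
    refine le_of_mul_le_mul_left ?_ hnn
    calc (1 - δ) ^ 2 * ((2 * η + 2 * δ * Nξ) * (1 - 2 * δ))
        = (1 - δ) ^ 2 * (2 * η + 2 * δ * Nξ) * (1 - 2 * δ) := by ring
      _ ≤ 2 * δ * (1 + δ ^ 2) * g * (1 - 2 * δ) := by gcongr
      _ = 2 * δ * g * ((1 + δ ^ 2) * (1 - 2 * δ)) := by ring
      -- `(1 - δ)² - (1 + δ²) (1 - 2 δ) = 2 δ³`. This slack is why a radius of order `δ²` leaves no
      -- trace in the final constant.
      _ ≤ 2 * δ * g * (1 - δ) ^ 2 := by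
          gcongr
          have : 0 ≤ δ ^ 3 := by positivity
          nlinarith
      _ = _ := by ring
  · have a1 : m * (1 - δ) ≤ Nξ * (1 - δ) := by gcongr
    have a2 : (1 + δ) * δ ^ 2 * m ≤ (1 - δ) * m := by
      gcongr
      nlinarith
    linarith

section deterministic

variable {d n : ℕ} {δ : ℝ} {N : Vec d → ℝ} {x : Fin n → Vec d}
  {G : Matrix (Fin d) (Fin d) ℝ}

/-- The robust energies `N` of the sample `x` are accurate estimates of the energies of `G`. -/
structure GoodSample (δ : ℝ) (N : Vec d → ℝ) (x : Fin n → Vec d)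
    (G : Matrix (Fin d) (Fin d) ℝ) : Prop where
  isHermitian : G.IsHermitian
  quadForm_nonneg : ∀ θ, 0 ≤ quadForm G θ
  delta_nonneg : 0 ≤ δ
  delta_lt : δ < 1 / 2
  nonneg : ∀ θ, 0 ≤ N θ
  mul_le : ∀ θ, (1 - δ) * N θ ≤ quadForm G θ
  le_mul : ∀ θ, quadForm G θ ≤ (1 + δ) * N θ
  quadForm_eq_zero : ∀ θ ∈ (Submodule.span ℝ (Set.range x))ᗮ, quadForm G θ = 0
  mem_orthogonal : ∀ θ, quadForm G θ = 0 → θ ∈ (Submodule.span ℝ (Set.range x))ᗮ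

namespace GoodSample

theorem isSymm (h : GoodSample δ N x G) : G.IsSymm := by
  simpa [Matrix.IsHermitian, Matrix.IsSymm] using h.isHermitian

theorem mulVec_mem (h : GoodSample δ N x G) (v : Vec d) :
    WithLp.toLp 2 (G.mulVec v.ofLp) ∈ Submodule.span ℝ (Set.range x) :=
  mem_span_of_quadForm h.isHermitian h.quadForm_nonneg h.quadForm_eq_zero v

theorem mem_feasible (h : GoodSample δ N x G) (Θ : Finset (Vec d)) : G ∈ feasible δ N x Θ :=
  ⟨h.isSymm, h.mulVec_mem, fun θ _ =>
    ⟨by linarith [h.mul_le θ], by linarith [h.le_mul θ]⟩⟩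

theorem quadForm_pos (h : GoodSample δ N x G) {θ : Vec d} (hθ : θ ∈ spanSphere x) :
    0 < quadForm G θ := by
  refine (h.quadForm_nonneg θ).lt_of_ne fun h0 => ?_
  have h1 := h.mem_orthogonal θ h0.symm θ hθ.1
  rw [real_inner_self_eq_norm_sq, hθ.2] at h1
  norm_num at h1

theorem lambdaMin_nonneg (h : GoodSample δ N x G) : 0 ≤ lambdaMin N x :=
  Real.sInf_nonneg (by rintro _ ⟨θ, _, rfl⟩; exact h.nonneg θ)

theorem lambdaMin_le (h : GoodSample δ N x G) {θ : Vec d} (hθ : θ ∈ spanSphere x) :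
    lambdaMin N x ≤ N θ :=
  csInf_le ⟨0, by rintro _ ⟨θ, _, rfl⟩; exact h.nonneg θ⟩ ⟨θ, hθ, rfl⟩

/-- No continuity of `N` is available. The continuous form of `G` is positive on the compact sphere
of the span, and it bounds `N` from below up to the factor `1 + δ`. -/
theorem lambdaMin_pos (h : GoodSample δ N x G) (hne : (spanSphere x).Nonempty) :
    0 < lambdaMin N x := by
  have hq : Continuous fun θ : Vec d => quadForm G θ := by unfold quadForm; fun_prop
  obtain ⟨ξ, hξ, hmin⟩ := (isCompact_spanSphere x).exists_isMinOn hne hq.continuousOn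
  have hδ : 0 < 1 + δ := by linarith [h.delta_nonneg]
  refine (div_pos (h.quadForm_pos hξ) hδ).trans_le (le_csInf (hne.image _) ?_)
  rintro _ ⟨θ, hθ, rfl⟩
  rw [div_le_iff₀ hδ]
  have h1 : quadForm G ξ ≤ quadForm G θ := hmin hθ
  linarith [h.le_mul θ]

theorem exists_admissible (h : GoodSample δ N x G) (hδ : 0 < d → 0 < δ) :
    ∃ e ρ Θ, IsSmallRadius δ N x e ρ ∧ IsNet x ρ Θ := by
  set e := EuclideanSpace.basisFun (Fin d) ℝ
  have hS : 0 ≤ ∑ i, N (e i) := Finset.sum_nonneg fun i _ => h.nonneg _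
  have hrad : ∃ ρ, IsSmallRadius δ N x e ρ := by
    -- If the sample vanishes, then so does `N`, and the radius condition reads `0 ≤ δ² · 0`, so
    -- that any positive radius is allowed.
    rcases (spanSphere x).eq_empty_or_nonempty with hemp | hne
    · have hall : ∀ θ ∈ Submodule.span ℝ (Set.range x), θ = 0 := by
        intro θ hθ
        by_contra h0
        have : ‖θ‖⁻¹ • θ ∈ spanSphere x :=
          ⟨Submodule.smul_mem _ _ hθ, norm_smul_inv_norm (𝕜 := ℝ) h0⟩
        rw [hemp] at this
        exact this
      have hN0 : ∀ θ, N θ = 0 := by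
        intro θ
        have h0 := h.quadForm_eq_zero θ fun u hu => by rw [hall u hu, inner_zero_left]
        have h1 := h.mul_le θ
        rw [h0] at h1
        exact le_antisymm (nonpos_of_mul_nonpos_right h1 (by linarith [h.delta_lt])) (h.nonneg θ)
      refine ⟨1, one_pos, ?_⟩
      simp only [hN0, Finset.sum_const_zero, mul_zero]
      exact mul_nonneg (sq_nonneg _) h.lambdaMin_nonneg
    · have hd : 0 < d := by
        rcases Nat.eq_zero_or_pos d with h0 | h0
        · subst h0
          obtain ⟨θ, hθ⟩ := hne
          have := hθ.2
          rw [Subsingleton.elim θ 0, norm_zero] at this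
          norm_num at this
        · exact h0
      have hm := h.lambdaMin_pos hne
      have hδ0 := hδ hd
      -- The added `1` keeps the denominator positive without any discussion of the sum.
      refine ⟨δ ^ 2 * lambdaMin N x / (2 * ∑ i, N (e i) + 1), by positivity, ?_⟩
      rw [div_mul_eq_mul_div, div_le_iff₀ (by positivity)]
      gcongr
      linarith
  obtain ⟨ρ, hρ⟩ := hrad
  obtain ⟨t, hts, htf, hcov⟩ := (isCompact_spanSphere x).finite_cover_balls hρ.1
  refine ⟨e, ρ, htf.toFinset, hρ, fun ξ hξ => hts (by simpa using hξ), fun θ hθ => ?_⟩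
  obtain ⟨ξ, hξ, hd⟩ := Set.mem_iUnion₂.1 (hcov hθ)
  exact ⟨ξ, by simpa using hξ, by rw [← dist_eq_norm]; exact (Metric.mem_ball.1 hd).le⟩

/-- Every solution of the minimization problem has a quadratic form close to that of `G`. -/
theorem abs_quadForm_sub_le (h : GoodSample δ N x G) {e : OrthonormalBasis (Fin d) ℝ (Vec d)}
    {ρ : ℝ} {Θ : Finset (Vec d)} (hρ : IsSmallRadius δ N x e ρ) (hΘ : IsNet x ρ Θ)
    {H : Matrix (Fin d) (Fin d) ℝ} (hH : IsGramSolution δ N x Θ H) (θ : Vec d) :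
    |quadForm H θ - quadForm G θ| ≤ 2 * δ / (1 - 2 * δ) * quadForm G θ ∧ 0 ≤ quadForm H θ := by
  set V := Submodule.span ℝ (Set.range x)
  have hm := h.lambdaMin_nonneg
  have hsphere : ∀ θ ∈ spanSphere x,
      |quadForm H θ - quadForm G θ| ≤ 2 * δ / (1 - 2 * δ) * quadForm G θ ∧ 0 ≤ quadForm H θ := by
    intro θ hθ
    obtain ⟨ξ, hξΘ, hθξ⟩ := hΘ.2 θ hθ
    have hξ := hΘ.1 ξ hξΘ
    have hfr : √(G * G).trace ≤ (1 + δ) * ∑ i, N (e i) := by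
      refine (sqrt_trace_mul_self_le h.isHermitian h.quadForm_nonneg e).trans ?_
      rw [Finset.mul_sum]
      exact Finset.sum_le_sum fun i _ => h.le_mul _
    have hδ0 := h.delta_nonneg
    -- This applies to `G` and to `H` alike: `G` is feasible, so minimality bounds the Frobenius
    -- norm of `H` by that of `G`.
    have hstep : ∀ K : Matrix (Fin d) (Fin d) ℝ, K.IsSymm → (K * K).trace ≤ (G * G).trace →
        |quadForm K θ - quadForm K ξ| ≤ (1 + δ) * δ ^ 2 * lambdaMin N x := by
      intro K hK htr
      refine (RobustGram.abs_quadForm_sub_le hK hθ.2 hξ.2).trans ?_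
      have h1 : √(K * K).trace ≤ (1 + δ) * ∑ i, N (e i) := (Real.sqrt_le_sqrt htr).trans hfr
      have hS : 0 ≤ ∑ i, N (e i) := Finset.sum_nonneg fun i _ => h.nonneg _
      calc 2 * √(K * K).trace * ‖θ - ξ‖ ≤ 2 * ((1 + δ) * ∑ i, N (e i)) * ρ := by gcongr
        _ = (1 + δ) * (ρ * (2 * ∑ i, N (e i))) := by ring
        _ ≤ (1 + δ) * (δ ^ 2 * lambdaMin N x) :=
            mul_le_mul_of_nonneg_left hρ.2 (by linarith)
        _ = _ := by ring
    exact abs_sub_le_of_net hδ0 h.delta_lt hm le_rfl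
      (hstep H hH.1.1 (hH.2 G (h.mem_feasible Θ))) (hstep G h.isSymm le_rfl)
      (hH.1.2.2 ξ hξΘ).1 (hH.1.2.2 ξ hξΘ).2 (h.mul_le ξ) (h.le_mul ξ)
      (h.lambdaMin_le hξ) (h.lambdaMin_le hθ) (h.mul_le θ)
  -- Both images are in the span, so the component `w` is invisible to both forms, and homogeneity
  -- reduces `v` to the sphere.
  obtain ⟨v, hv, w, hw, rfl⟩ := V.exists_add_mem_mem_orthogonal θ
  rw [quadForm_add_of_mem_orthogonal hH.1.1 hH.1.2.1 hw,
    quadForm_add_of_mem_orthogonal h.isSymm h.mulVec_mem hw]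
  rcases eq_or_ne v 0 with rfl | hv0
  · simp [quadForm]
  · have hs : ‖v‖⁻¹ • v ∈ spanSphere x :=
      ⟨Submodule.smul_mem _ _ hv, norm_smul_inv_norm (𝕜 := ℝ) hv0⟩
    have hvs : v = ‖v‖ • ‖v‖⁻¹ • v := by
      rw [smul_smul, mul_inv_cancel₀ (norm_ne_zero_iff.2 hv0), one_smul]
    obtain ⟨h1, h2⟩ := hsphere _ hs
    rw [hvs, quadForm_smul H, quadForm_smul G, ← mul_sub, abs_mul, abs_of_nonneg (sq_nonneg _)]
    refine ⟨?_, by positivity⟩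
    calc _ ≤ ‖v‖ ^ 2 * (2 * δ / (1 - 2 * δ) * quadForm G (‖v‖⁻¹ • v)) := by gcongr
      _ = _ := by ring

end GoodSample

end deterministic

/-! ### Assembling the estimator -/

theorem two_delta_div_eq {κ ε : ℝ} {n d : ℕ} (hμ : 4 * mu κ ε n d < 1) :
    2 * delta κ ε n d / (1 - 2 * delta κ ε n d) = 2 * mu κ ε n d / (1 - 4 * mu κ ε n d) := by
  have h0 := mu_nonneg (κ := κ) (ε := ε) (n := n) (d := d)
  have h1 := delta_lt hμ
  have h2 := delta_mul hμ
  rw [div_eq_div_iff (by linarith) (by linarith)]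
  linear_combination 2 * h2

/-- Both square roots in `mu` are at most `√2` times the target, and `2 (1 + 6.81) √2 < 23`. -/
theorem mu_le {κ ε : ℝ} (hκ : 1 < κ) (hε : 0 < ε) (hε1 : ε ≤ 1) (n d : ℕ) :
    2 * mu κ ε n d ≤ 23 * √(κ * (d + Real.log ε⁻¹) / n) := by
  have hl : 0 ≤ Real.log ε⁻¹ := Real.log_nonneg ((one_le_inv₀ hε).2 hε1)
  have hd : (0:ℝ) ≤ d := Nat.cast_nonneg d
  have h2 : √2 ≤ 1.4143 := Real.sqrt_le_iff.2 ⟨by norm_num, by norm_num⟩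
  set r := √(κ * (d + Real.log ε⁻¹) / n)
  have hr : √2 * r = √(2 * (κ * (d + Real.log ε⁻¹) / n)) := (Real.sqrt_mul zero_le_two _).symm
  have h3 : √(2 * (κ - 1) / n * logTerm ε d) ≤ √2 * r := by
    rw [hr]
    refine Real.sqrt_le_sqrt ?_
    have : logTerm ε d ≤ d + Real.log ε⁻¹ := by unfold logTerm; linarith
    have hL : 0 ≤ logTerm ε d := by unfold logTerm; positivity
    calc 2 * (κ - 1) / n * logTerm ε d ≤ 2 * κ / n * (d + Real.log ε⁻¹) := by
          gcongr; linarith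
      _ = _ := by ring
  have h4 : √(2 * κ * d / n) ≤ √2 * r := by
    rw [hr]
    refine Real.sqrt_le_sqrt ?_
    calc 2 * κ * d / n ≤ 2 * κ * (d + Real.log ε⁻¹) / n := by
          gcongr; linarith
      _ = _ := by ring
  have hr0 : 0 ≤ r := Real.sqrt_nonneg _
  unfold mu
  nlinarith

/-- The hypotheses of the deterministic part are satisfied by the robust energy estimator, as soon
as it is accurate and the sample is in the range of the Gram matrix. -/
theorem goodSample_of_Nhat {d n : ℕ} {δ lam : ℝ} {P : Measure (Vec d)}
    (hP : MemLp (fun x : Vec d => x) 2 P) (hlam : 0 ≤ lam) (hδ0 : 0 ≤ δ) (hδ : δ < 1 / 2)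
    {x : Fin n → Vec d} (hx : ∀ i, x i ∈ gramRange P)
    (h : ∀ θ, (1 - δ) * Nhat lam x θ ≤ energy P θ ∧ energy P θ ≤ (1 + δ) * Nhat lam x θ) :
    GoodSample δ (Nhat lam x) x (gramMatrix P) where
  isHermitian := gramMatrix_isHermitian P
  quadForm_nonneg θ := by rw [quadForm_gramMatrix hP]; exact energy_nonneg P θ
  delta_nonneg := hδ0
  delta_lt := hδ
  nonneg := Nhat_nonneg lam x
  mul_le θ := by rw [quadForm_gramMatrix hP]; exact (h θ).1
  le_mul θ := by rw [quadForm_gramMatrix hP]; exact (h θ).2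
  -- A direction orthogonal to the sample has zero robust energy, so the upper bound forces its true
  -- energy to vanish: the sample spans the whole image of `G`.
  quadForm_eq_zero θ hθ := by
    have h1 := (h θ).2
    rw [Nhat_eq_zero hlam (mem_span_orthogonal_iff.1 hθ), mul_zero] at h1
    rw [quadForm_gramMatrix hP]
    exact le_antisymm h1 (energy_nonneg P θ)
  mem_orthogonal θ hθ := by
    rw [quadForm_gramMatrix hP] at hθ
    exact mem_span_orthogonal_iff.2 fun i => inner_eq_zero_of_mem_gramRange hP (hx i) hθ

theorem GoodSample.isAccurate {d n : ℕ} {δ : ℝ} {N : Vec d → ℝ} {x : Fin n → Vec d}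
    {P : Measure (Vec d)} (h : GoodSample δ N x (gramMatrix P))
    {e : OrthonormalBasis (Fin d) ℝ (Vec d)} {ρ : ℝ} {Θ : Finset (Vec d)}
    (hρ : IsSmallRadius δ N x e ρ) (hΘ : IsNet x ρ Θ) {H : Matrix (Fin d) (Fin d) ℝ}
    (hH : IsGramSolution δ N x Θ H) : IsAccurate P (2 * δ / (1 - 2 * δ)) H := by
  have hc : 0 ≤ 2 * δ / (1 - 2 * δ) :=
    div_nonneg (by linarith [h.delta_nonneg]) (by linarith [h.delta_lt])
  have hq := h.abs_quadForm_sub_le hρ hΘ hH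
  have hHh : H.IsHermitian := by
    simpa [Matrix.IsHermitian, Matrix.IsSymm] using hH.1.1
  refine ⟨fun θ => ratioErrLE_of_abs_sub_le (h.quadForm_nonneg θ) hc (hq θ).1, hHh, fun i => ?_⟩
  refine ratioErrLE_of_abs_sub_le ?_ hc (abs_eigenvalues_sub_le _ hHh hc h.quadForm_nonneg
    (fun θ => (hq θ).2) (fun θ => (hq θ).1) i)
  rw [← quadForm_sortedBasis]
  exact h.quadForm_nonneg _

open scoped Classical in
/-- A result of the construction, chosen whenever there is one. -/
noncomputable def gramEstimator (κ ε : ℝ) {d n : ℕ} (x : Fin n → Vec d) :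
    Matrix (Fin d) (Fin d) ℝ :=
  if h : ∃ H, IsOutput κ ε x H then h.choose else 0

theorem isOutput_gramEstimator {κ ε : ℝ} {d n : ℕ} {x : Fin n → Vec d}
    (h : ∃ H, IsOutput κ ε x H) : IsOutput κ ε x (gramEstimator κ ε x) := by
  unfold gramEstimator
  rw [dif_pos h]
  exact h.choose_spec

theorem isSymm_gramEstimator (κ ε : ℝ) {d n : ℕ} (x : Fin n → Vec d) :
    (gramEstimator κ ε x).IsSymm := by
  by_cases h : ∃ H, IsOutput κ ε x H
  · obtain ⟨_, _, _, _, hsol⟩ := isOutput_gramEstimator h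
    exact hsol.1.1
  · unfold gramEstimator
    rw [dif_neg h]
    exact Matrix.isSymm_zero

end RobustGram

theorem proposition1p2 :
    ∃ C : ℝ, 0 < C ∧ ∀ (d n : ℕ) (κ ε : ℝ), 1 < κ → 0 < ε →
      RobustGram.sampleBound κ ε d < n → 4 * RobustGram.mu κ ε n d < 1 →
      (ε ≤ 1 →
        2 * RobustGram.mu κ ε n d / (1 - 4 * RobustGram.mu κ ε n d) ≤
          C / (1 - 4 * RobustGram.mu κ ε n d) * √(κ * (d + Real.log ε⁻¹) / n)) ∧
      ∃ Ghat : (Fin n → RobustGram.Vec d) → Matrix (Fin d) (Fin d) ℝ,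
        (∀ x, (Ghat x).IsSymm) ∧
        (∀ x, (∃ H, RobustGram.IsOutput κ ε x H) → RobustGram.IsOutput κ ε x (Ghat x)) ∧
        ∀ (P : Measure (RobustGram.Vec d)) [IsProbabilityMeasure P],
          MemLp (fun x : RobustGram.Vec d => x) 2 P →
          RobustGram.kurtosis P ≤ ENNReal.ofReal κ →
          ∀ (Ω : Type*) [MeasurableSpace Ω] (Pr : Measure Ω) [IsProbabilityMeasure Pr]
            (X : Fin n → Ω → RobustGram.Vec d),
            (∀ i, Measurable (X i)) → (∀ i, Pr.map (X i) = P) → iIndepFun X Pr →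
            ∃ B : Set Ω, MeasurableSet B ∧ ENNReal.ofReal (1 - 2 * ε) ≤ Pr B ∧
              ∀ ω ∈ B,
                RobustGram.IsOutput κ ε (fun i => X i ω) (Ghat fun i => X i ω) ∧
                RobustGram.IsAccurate P
                  (2 * RobustGram.mu κ ε n d / (1 - 4 * RobustGram.mu κ ε n d))
                  (Ghat fun i => X i ω) ∧
                ∀ e ρ Θ, RobustGram.IsAdmissible κ ε (fun i => X i ω) e ρ Θ →
                  (∃ H, RobustGram.IsGramSolution (RobustGram.delta κ ε n d)
                    (RobustGram.Nhat (RobustGram.scale κ ε n d) fun i => X i ω)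
                    (fun i => X i ω) Θ H) ∧
                  ∀ H, RobustGram.IsGramSolution (RobustGram.delta κ ε n d)
                    (RobustGram.Nhat (RobustGram.scale κ ε n d) fun i => X i ω)
                    (fun i => X i ω) Θ H →
                    RobustGram.IsAccurate P
                      (2 * RobustGram.mu κ ε n d / (1 - 4 * RobustGram.mu κ ε n d)) H := by
  refine ⟨23, by norm_num, fun d n κ ε hκ hε hn hμ => ⟨fun hε1 => ?_, RobustGram.gramEstimator κ ε,
    RobustGram.isSymm_gramEstimator κ ε, fun x => RobustGram.isOutput_gramEstimator, ?_⟩⟩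
  · rw [div_mul_eq_mul_div]
    exact div_le_div_of_nonneg_right (RobustGram.mu_le hκ hε hε1 n d) (by linarith)
  intro P _ hP hkurt Ω _ Pr _ X hX hmap hind
  -- For `ε ≥ 1 / 2` the required probability is nonpositive, and the empty event suffices.
  rcases le_or_gt (1 / 2) ε with hε2 | hε2
  · refine ⟨∅, MeasurableSet.empty, ?_, fun ω hω => absurd hω (Set.notMem_empty ω)⟩
    rw [ENNReal.ofReal_of_nonpos (by linarith)]
    exact zero_le
  obtain ⟨B, hBm, hB, hBω⟩ :=
    RobustGram.exists_event_Nhat hκ hε hε2 hn hμ hP hkurt hX hmap hind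
  refine ⟨B, hBm, hB, fun ω hω => ?_⟩
  have hn0 : 0 < n := by exact_mod_cast (sq_nonneg _).trans_lt hn
  obtain ⟨hR, hN⟩ := hBω ω hω
  have hgood := RobustGram.goodSample_of_Nhat hP (Real.sqrt_nonneg _)
    (RobustGram.delta_nonneg hμ) (RobustGram.delta_lt hμ) hR hN
  have hacc : ∀ e ρ Θ, RobustGram.IsAdmissible κ ε (fun i => X i ω) e ρ Θ →
      ∀ H, RobustGram.IsGramSolution (RobustGram.delta κ ε n d)
        (RobustGram.Nhat (RobustGram.scale κ ε n d) fun i => X i ω) (fun i => X i ω) Θ H →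
      RobustGram.IsAccurate P
        (2 * RobustGram.mu κ ε n d / (1 - 4 * RobustGram.mu κ ε n d)) H := by
    intro e ρ Θ hadm H hH
    rw [← RobustGram.two_delta_div_eq hμ]
    exact hgood.isAccurate hadm.1 hadm.2 hH
  have hout : ∃ H, RobustGram.IsOutput κ ε (fun i => X i ω) H := by
    obtain ⟨e, ρ, Θ, hρ, hΘ⟩ := hgood.exists_admissible fun hd =>
      div_pos (RobustGram.mu_pos hκ hn0 hd)
        (by linarith [RobustGram.mu_nonneg (κ := κ) (ε := ε) (n := n) (d := d)])
    obtain ⟨H, hH⟩ := RobustGram.exists_isGramSolution (hgood.mem_feasible Θ)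
    exact ⟨H, e, ρ, Θ, ⟨hρ, hΘ⟩, hH⟩
  have hG := RobustGram.isOutput_gramEstimator hout
  refine ⟨hG, ?_, fun e ρ Θ hadm => ⟨?_, hacc e ρ Θ hadm⟩⟩
  · obtain ⟨e, ρ, Θ, hadm, hsol⟩ := hG
    exact hacc e ρ Θ hadm _ hsol
  · exact RobustGram.exists_isGramSolution (hgood.mem_feasible Θ)
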